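/- Let $k$ be a field and let $B = k[x_1,\dots,x_n]$ with its standard grading ($\deg x_j = 1$). For a $\mathbb Z$-graded vector space $V$ let $\operatorname{end} V$ be the largest degree in which $V$ is nonzero, with $\operatorname{end} V = \infty$ if these degrees are not bounded above and $\operatorname{end} V = -\infty$ if $V = 0$. For a homogeneous ideal $I$ of $B$ let $t^B_1(I) = \operatorname{end} \operatorname{Tor}^B_1(I,k)$, where $k = B/(x_1,\dots,x_n)$ and $\operatorname{Tor}$ carries the grading computed from any graded free resolution of $I$. Let $I$ be an ideal of $B$ with $\operatorname{end}(B/I) < \infty$ and let $f_1,\dots,f_m$ be homogeneous generators of $I$, with $f_j$ of degree $d_j$, that are minimal by degree: if for some $c$ those $f_j$ with $d_j < c$ already generate $I$, then $d_j < c$ for all $j$. (Every irredundant system of homogeneous generators has this property.) Let $K(f;B)$ be the Koszul complex on $f_1,\dots,f_m$, graded so that the basis element $e_{j_1}\wedge\dots\wedge e_{j_i}$ of $K_i(f;B)$ has degree $d_{j_1}+\dots+d_{j_i}$, and let $H_i(f;B)$ be its homology. Then for all $i \ge 0$ $$\operatorname{end} H_i(f;B) \le (\operatorname{end}(B/I)+2)(i+1)-2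 .$$ If, moreover, $t^B_1(I) \le \operatorname{end}(B/I)+1$, then for all $i \ge 0$ $$\operatorname{end} H_i(f;B) \le (\operatorname{end}(B/I)+1)(i+1)-1 .$$ -/

import Mathlib

open scoped BigOperators

universe u w

/-! ### Graded pieces and ends -/

/-- The end of a `ℤ`-graded vector space `V = ⨁ V_e`: the largest `e` with `V_e ≠ 0`. It is
`⊤` if these degrees are not bounded above, and `⊥` if there are none. -/
noncomputable def gradedEnd {k : Type*} [Field k] {V : Type*} [AddCommGroup V] [Module k V]
    (piece : ℤ → Submodule k V) : EReal :=
  sSup ((fun e : ℤ => ((e : ℝ) : EReal)) '' {e : ℤ | piece e ≠ ⊥})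

/-- The degree `e` part of the standard graded polynomial ring `k[x_1, …, x_n]`, for `e ∈ ℤ`;
it is zero if `e < 0`. -/
noncomputable def polyPiece (k : Type*) [Field k] (n : ℕ) (e : ℤ) :
    Submodule k (MvPolynomial (Fin n) k) :=
  if 0 ≤ e then MvPolynomial.homogeneousSubmodule (Fin n) k e.toNat else ⊥

/-- The degree `e` part of `B / I`, where `B = k[x_1, …, x_n]`. -/
noncomputable def quotientPiece {k : Type*} [Field k] {n : ℕ}
    (I : Ideal (MvPolynomial (Fin n) k)) (e : ℤ) :
    Submodule k (MvPolynomial (Fin n) k ⧸ I) :=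
  (polyPiece k n e).map (Ideal.Quotient.mkₐ k I).toLinearMap

/-- `end (B / I)`. -/
noncomputable def endQuotient {k : Type*} [Field k] {n : ℕ}
    (I : Ideal (MvPolynomial (Fin n) k)) : EReal :=
  gradedEnd (quotientPiece I)

/-- The quotient `Z / (Y ∩ Z)` of submodules of `M`. It is the homology `Z / Y` if `Z` consists of
the cycles and `Y ≤ Z` of the boundaries. -/
abbrev Subquotient {R M : Type*} [CommRing R] [AddCommGroup M] [Module R M]
    (Z Y : Submodule R M) :=
  Z ⧸ Y.submoduleOf Z

/-- The subspace of classes in `Z / (Y ∩ Z)` of the elements of `Z` that lie in `P`. -/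
noncomputable def subquotientPiece (k : Type*) {R M : Type*} [Field k] [CommRing R] [Algebra k R]
    [AddCommGroup M] [Module R M] [Module k M] [IsScalarTower k R M]
    (Z Y : Submodule R M) (P : Submodule k M) : Submodule k (Subquotient Z Y) :=
  (P.comap (Z.subtype.restrictScalars k)).map ((Y.submoduleOf Z).mkQ.restrictScalars k)

/-! ### Homogeneous generators that are minimal by degree -/

/-- The family `f`, with `f j` homogeneous of degree `deg j`, is minimal by degree as a family of
generators of the ideal it generates: the members of degree `< c` generate the same ideal only
if they are all the members. In particular every irredundant family of homogeneous generators is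
minimal by degree. -/
structure IsMinimalByDegree {k : Type*} [Field k] {n m : ℕ}
    (f : Fin m → MvPolynomial (Fin n) k) (deg : Fin m → ℕ) : Prop where
  homogeneous : ∀ j, (f j).IsHomogeneous (deg j)
  minimal : ∀ c : ℕ, Ideal.span (f '' {j | deg j < c}) = Ideal.span (Set.range f) →
    ∀ j, deg j < c

/-! ### The Koszul complex `K(f; B)` and its homology

`K_i` is the exterior power `⋀^i (B^m)`, inside the exterior algebra of `B^m`. -/

section Koszul

variable {k : Type*} [Field k] {n m : ℕ}

/-- The Koszul differential: contraction with the linear form `e_j ↦ f_j` on `B^m`. So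
`d (e_{j_1} ∧ ⋯ ∧ e_{j_i}) = ∑_l (-1)^(l-1) f_{j_l} e_{j_1} ∧ ⋯ (omit e_{j_l}) ⋯ ∧ e_{j_i}`. -/
noncomputable def koszulD (f : Fin m → MvPolynomial (Fin n) k) :
    ExteriorAlgebra (MvPolynomial (Fin n) k) (Fin m → MvPolynomial (Fin n) k)
      →ₗ[MvPolynomial (Fin n) k]
    ExteriorAlgebra (MvPolynomial (Fin n) k) (Fin m → MvPolynomial (Fin n) k) :=
  CliffordAlgebra.contractLeft (Q := 0)
    (Fintype.linearCombination (MvPolynomial (Fin n) k) f)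

/-- The cycles in `K_i`. -/
noncomputable def koszulCycles (f : Fin m → MvPolynomial (Fin n) k) (i : ℕ) :
    Submodule (MvPolynomial (Fin n) k)
      (ExteriorAlgebra (MvPolynomial (Fin n) k) (Fin m → MvPolynomial (Fin n) k)) :=
  LinearMap.ker (koszulD f) ⊓
    ⋀[MvPolynomial (Fin n) k]^i (Fin m → MvPolynomial (Fin n) k)

/-- The boundaries in `K_i`, i.e. the image of `K_{i+1}`. -/
noncomputable def koszulBoundaries (f : Fin m → MvPolynomial (Fin n) k) (i : ℕ) :
    Submodule (MvPolynomial (Fin n) k)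
      (ExteriorAlgebra (MvPolynomial (Fin n) k) (Fin m → MvPolynomial (Fin n) k)) :=
  (⋀[MvPolynomial (Fin n) k]^(i + 1) (Fin m → MvPolynomial (Fin n) k)).map (koszulD f)

/-- The differential maps `K_{i+1}` to `K_i`. -/
theorem koszulD_mem (f : Fin m → MvPolynomial (Fin n) k) (i : ℕ)
    (x : ExteriorAlgebra (MvPolynomial (Fin n) k) (Fin m → MvPolynomial (Fin n) k))
    (hx : x ∈ ⋀[MvPolynomial (Fin n) k]^(i + 1) (Fin m → MvPolynomial (Fin n) k)) :
    koszulD f x ∈ ⋀[MvPolynomial (Fin n) k]^i (Fin m → MvPolynomial (Fin n) k) := by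
  induction i generalizing x with
  | zero =>
    have hx' : x ∈ LinearMap.range (ExteriorAlgebra.ι (MvPolynomial (Fin n) k)
        (M := Fin m → MvPolynomial (Fin n) k)) := by simpa using hx
    obtain ⟨v, rfl⟩ := hx'
    have h : koszulD f (ExteriorAlgebra.ι (MvPolynomial (Fin n) k) v) = _ :=
      CliffordAlgebra.contractLeft_ι (Q := 0)
        (Fintype.linearCombination (MvPolynomial (Fin n) k) f) v
    rw [h, ExteriorAlgebra.exteriorPower, pow_zero]
    exact Submodule.algebraMap_mem _
  | succ i ih =>
    rw [ExteriorAlgebra.exteriorPower, pow_succ'] at hx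
    induction hx using Submodule.mul_induction_on' with
    | mem_mul_mem y hy z hz =>
      obtain ⟨v, rfl⟩ := hy
      have h : koszulD f (ExteriorAlgebra.ι (MvPolynomial (Fin n) k) v * z) = _ :=
        CliffordAlgebra.contractLeft_ι_mul (Q := 0)
          (Fintype.linearCombination (MvPolynomial (Fin n) k) f) v z
      rw [h]
      refine Submodule.sub_mem _ (Submodule.smul_mem _ _ hz) ?_
      rw [ExteriorAlgebra.exteriorPower, pow_succ']
      exact Submodule.mul_mem_mul ⟨v, rfl⟩ (ih z hz)
    | add y _ z _ hy hz =>
      rw [map_add]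
      exact Submodule.add_mem _ hy hz

/-- Boundaries are cycles. -/
theorem koszulBoundaries_le_koszulCycles (f : Fin m → MvPolynomial (Fin n) k) (i : ℕ) :
    koszulBoundaries f i ≤ koszulCycles f i := by
  rintro _ ⟨x, hx, rfl⟩
  exact ⟨CliffordAlgebra.contractLeft_contractLeft (Q := 0) _ x, koszulD_mem f i x hx⟩

/-- The Koszul homology `H_i(f; B)`. -/
abbrev KoszulHomology (f : Fin m → MvPolynomial (Fin n) k) (i : ℕ) :=
  Subquotient (koszulCycles f i) (koszulBoundaries f i)

/-- The degree `e` part of `K_i`, where the basis vector `e_j` of `B^m` has degree `deg j`: it is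
spanned by the `b e_{j_1} ∧ ⋯ ∧ e_{j_i}` with `b` homogeneous of degree
`e - deg j_1 - ⋯ - deg j_i`. -/
noncomputable def koszulPiece (k : Type*) [Field k] (n : ℕ) {m : ℕ} (deg : Fin m → ℕ)
    (i : ℕ) (e : ℤ) :
    Submodule k
      (ExteriorAlgebra (MvPolynomial (Fin n) k) (Fin m → MvPolynomial (Fin n) k)) :=
  Submodule.span k {x | ∃ (s : Fin i → Fin m) (b : MvPolynomial (Fin n) k),
    b ∈ polyPiece k n (e - ∑ l, (deg (s l) : ℤ)) ∧
    x = b • ExteriorAlgebra.ιMulti (MvPolynomial (Fin n) k) i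
      (fun l => (Pi.single (s l) 1 : Fin m → MvPolynomial (Fin n) k))}

/-- The degree `e` part of `H_i(f; B)`: the classes of the cycles of degree `e`. -/
noncomputable def koszulHomologyPiece (f : Fin m → MvPolynomial (Fin n) k) (deg : Fin m → ℕ)
    (i : ℕ) (e : ℤ) : Submodule k (KoszulHomology f i) :=
  subquotientPiece k (koszulCycles f i) (koszulBoundaries f i) (koszulPiece k n deg i e)

/-- `end H_i(f; B)`. -/
noncomputable def endKoszulHomology (f : Fin m → MvPolynomial (Fin n) k) (deg : Fin m → ℕ)
    (i : ℕ) : EReal :=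
  gradedEnd (koszulHomologyPiece f deg i)

end Koszul

/-! ### Graded free resolutions and `Tor_i^B(I, k)` -/

/-- The degree `e` part of the graded free `B`-module on basis elements of degrees `deg a`. -/
def freePiece {k : Type*} [Field k] {n : ℕ} {ι : Type*} (deg : ι → ℤ) (e : ℤ) :
    Set (ι →₀ MvPolynomial (Fin n) k) :=
  {v | ∀ a, v a ∈ polyPiece k n (e - deg a)}

/-- A graded free resolution `⋯ → F_2 → F_1 → F_0 → I → 0` of the ideal `I`, regarded as a graded
module over `B = k[x_1, …, x_n]`. The free module `F_i` has a basis indexed by `ι i`, with degrees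
`deg i`, and all maps preserve degree. -/
structure GradedFreeResolution {k : Type u} [Field k] {n : ℕ}
    (I : Ideal (MvPolynomial (Fin n) k)) where
  ι : ℕ → Type w
  deg : ∀ i, ι i → ℤ
  aug : (ι 0 →₀ MvPolynomial (Fin n) k) →ₗ[MvPolynomial (Fin n) k] MvPolynomial (Fin n) k
  d : ∀ i, (ι (i + 1) →₀ MvPolynomial (Fin n) k) →ₗ[MvPolynomial (Fin n) k]
    (ι i →₀ MvPolynomial (Fin n) k)
  aug_homogeneous : ∀ a, aug (Finsupp.single a 1) ∈ polyPiece k n (deg 0 a)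
  d_homogeneous : ∀ i a, d i (Finsupp.single a 1) ∈ freePiece (deg i) (deg (i + 1) a)
  range_aug : LinearMap.range aug = I
  exact_zero : LinearMap.range (d 0) = LinearMap.ker aug
  exact_succ : ∀ i, LinearMap.range (d (i + 1)) = LinearMap.ker (d i)

namespace GradedFreeResolution

variable {k : Type u} [Field k] {n : ℕ} {I : Ideal (MvPolynomial (Fin n) k)}
  (F : GradedFreeResolution.{u, w} I)

/-- The differential `F_{i+1} ⊗_B k → F_i ⊗_B k`, where `k = B / (x_1, …, x_n)` and `F_i ⊗_B k` is
the `k`-vector space on the basis of `F_i`: its matrix consists of the constant coefficients of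
the entries of the matrix of `F_{i+1} → F_i`. -/
noncomputable def dBar (i : ℕ) : (F.ι (i + 1) →₀ k) →ₗ[k] (F.ι i →₀ k) :=
  Finsupp.linearCombination k fun a =>
    (F.d i (Finsupp.single a 1)).mapRange MvPolynomial.constantCoeff (map_zero _)

/-- The cycles in `F_i ⊗_B k`. -/
noncomputable def torCycles : ∀ i : ℕ, Submodule k (F.ι i →₀ k)
  | 0 => ⊤
  | i + 1 => LinearMap.ker (F.dBar i)

/-- `Tor_i^B(I, k)`, as the homology of `F ⊗_B k`. -/
abbrev Tor (i : ℕ) :=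
  Subquotient (F.torCycles i) (LinearMap.range (F.dBar i))

/-- The degree `e` part of `Tor_i^B(I, k)`: the classes of the cycles that are combinations of
basis elements of degree `e`. -/
noncomputable def torPiece (i : ℕ) (e : ℤ) : Submodule k (F.Tor i) :=
  subquotientPiece k (F.torCycles i) (LinearMap.range (F.dBar i))
    (Finsupp.supported k k {a | F.deg i a = e})

/-- `t_i^B(I) = end Tor_i^B(I, k)`, computed from the graded free resolution `F` of `I`; the value
does not depend on `F`. -/
noncomputable def t (i : ℕ) : EReal := gradedEnd (F.torPiece i)

end GradedFreeResolution

/-! If `I` is the unit ideal, all Koszul homology vanishes. Otherwise let `r` be the end of `B / I`,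
let `K` be the Koszul complex, and let `G` be a graded free resolution of `B / I` with `G_0 = B` and
`G_1 = B^m` mapping to `B` by `f`. Minimality by degree bounds the degrees of `f` by `r + 1`, so the
basis of `K_i` lies in degrees at most `i * (r + 1)`.

The engine is a chase in `K ⊗ G`. Let `v ∈ K_i` be a cycle of large degree. Its coordinates have
degree `> r`, hence lie in `I`, and `v` comes from some `U ∈ K_i ⊗ G_1`. The coefficients of `U`
need not be cycles of `K`, but `U` can be corrected by an element of `K_i ⊗ G_2`, using exactness of
`G` and vanishing of lower Koszul homology in degrees shifted by those of `G_2, G_3, …`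
(`exists_isCycle_sub`). Then `v = ∑ f_a y_a` with cycles `y_a` (`exists_cycles_eq_sum`), and `v` is
a boundary because each `f_a` annihilates the homology. Induction on `i` shows that if `G_{q+2}`
lives in degrees at most `(q + 1) * c`, with `c ≥ r + 1`, then `H_i` vanishes in degrees above `r +
c * i` (`vanishAt_of_resolution`).

It remains to bound the degrees of `G`. The same chase, with `G` in the role of `K` and the linear
Koszul resolution of the residue field in the role of `G`, writes every syzygy of sufficiently large
degree as a combination, with the variables as coefficients, of syzygies of degree one less. So
`G_{q+1}` lives in degrees at most `r + q + 1` (`resolution_deg_le`), and `c = r + 2` gives the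
first bound.

If `t_1(I) ≤ r + 1`, comparing `f` with an arbitrary resolution of `I` shows that `G_2` lives in
degrees at most `r + 1` (`syzygiesGeneratedBy_of_t_le`). For `r ≥ 1` this permits `c = r + 1`. For
`r = 0` the numerical estimate fails, but then `I` is the ideal of the variables and the hypothesis
forces at most one variable (`subsingleton_of_syzygiesGeneratedBy`), a case settled by dividing
cycles by that variable. -/

/-! ### Homogeneous pieces and components of polynomials. -/

section Pieces

variable {k : Type*} [Field k] {n : ℕ}

theorem mem_polyPiece_natCast {p : MvPolynomial (Fin n) k} {d : ℕ} :
    p ∈ polyPiece k n (d : ℤ) ↔ p.IsHomogeneous d := by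
  simp [polyPiece, MvPolynomial.mem_homogeneousSubmodule]

theorem eq_zero_of_mem_polyPiece_neg {p : MvPolynomial (Fin n) k} {e : ℤ} (he : e < 0)
    (hp : p ∈ polyPiece k n e) : p = 0 := by
  simpa [polyPiece, not_le.mpr he] using hp

theorem one_mem_polyPiece : (1 : MvPolynomial (Fin n) k) ∈ polyPiece k n 0 :=
  mem_polyPiece_natCast (d := 0).mpr (MvPolynomial.isHomogeneous_one _ _)

theorem X_mem_polyPiece (i : Fin n) : (MvPolynomial.X i : MvPolynomial (Fin n) k) ∈ polyPiece k n 1 :=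
  mem_polyPiece_natCast (d := 1).mpr (MvPolynomial.isHomogeneous_X _ _)

theorem mul_mem_polyPiece {p q : MvPolynomial (Fin n) k} {d e : ℤ}
    (hp : p ∈ polyPiece k n d) (hq : q ∈ polyPiece k n e) : p * q ∈ polyPiece k n (d + e) := by
  rcases lt_or_ge d 0 with hd | hd
  · simp [eq_zero_of_mem_polyPiece_neg hd hp]
  rcases lt_or_ge e 0 with he | he
  · simp [eq_zero_of_mem_polyPiece_neg he hq]
  lift d to ℕ using hd
  lift e to ℕ using he
  rw [mem_polyPiece_natCast] at hp hq
  rw [← Nat.cast_add, mem_polyPiece_natCast]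
  exact hp.mul hq

/-- The homogeneous component of degree `e ∈ ℤ` of a polynomial. -/
noncomputable def polyComp (e : ℤ) : MvPolynomial (Fin n) k →ₗ[k] MvPolynomial (Fin n) k :=
  if 0 ≤ e then MvPolynomial.homogeneousComponent e.toNat else 0

theorem polyComp_mem (e : ℤ) (p : MvPolynomial (Fin n) k) : polyComp e p ∈ polyPiece k n e := by
  unfold polyComp polyPiece
  split_ifs with h
  · exact MvPolynomial.homogeneousComponent_isHomogeneous _ _
  · simp

theorem polyComp_of_mem {e d : ℤ} {p : MvPolynomial (Fin n) k} (hp : p ∈ polyPiece k n d) :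
    polyComp e p = if e = d then p else 0 := by
  rcases lt_or_ge d 0 with hd | hd
  · simp [eq_zero_of_mem_polyPiece_neg hd hp]
  lift d to ℕ using hd
  rw [mem_polyPiece_natCast] at hp
  rcases lt_or_ge e 0 with he | he
  · rw [if_neg (by omega)]
    simp [polyComp, not_le.mpr he]
  lift e to ℕ using he
  simp only [polyComp, Nat.cast_nonneg, if_true, Int.toNat_natCast, Nat.cast_inj]
  rw [MvPolynomial.homogeneousComponent_of_mem (m := e) hp]

theorem sum_polyComp (p : MvPolynomial (Fin n) k) :
    ∑ i ∈ Finset.range (p.totalDegree + 1), polyComp (i : ℤ) p = p := by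
  conv_rhs => rw [← MvPolynomial.sum_homogeneousComponent p]
  simp [polyComp]

theorem polyComp_mul {d : ℤ} {q : MvPolynomial (Fin n) k} (hq : q ∈ polyPiece k n d) (e : ℤ)
    (p : MvPolynomial (Fin n) k) : polyComp e (q * p) = q * polyComp (e - d) p := by
  conv_lhs => rw [← sum_polyComp p]
  conv_rhs => rw [← sum_polyComp p]
  simp only [Finset.mul_sum, map_sum]
  refine Finset.sum_congr rfl fun i _ => ?_
  rw [polyComp_of_mem (mul_mem_polyPiece hq (polyComp_mem _ _)),
    polyComp_of_mem (polyComp_mem (i : ℤ) p)]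
  by_cases h : e = d + i
  · rw [if_pos h, if_pos (by omega)]
  · rw [if_neg h, if_neg (by omega), mul_zero]

end Pieces

/-! ### Matrices as degree-preserving maps of graded free modules. -/

section GradedMatrices

variable {k : Type*} [Field k] {n : ℕ} {α β γ : Type*}

/-- A matrix over `k[x_1, …, x_n]` which defines a homogeneous map of degree `0` from the graded
free module on basis elements of degrees `c j` to the one on basis elements of degrees `r i`. -/
def GradedMat (r : α → ℤ) (c : β → ℤ) (A : Matrix α β (MvPolynomial (Fin n) k)) : Prop :=
  ∀ i j, A i j ∈ polyPiece k n (c j - r i)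

theorem GradedMat.mul [Fintype β] {r : α → ℤ} {s : β → ℤ} {t : γ → ℤ}
    {A : Matrix α β (MvPolynomial (Fin n) k)} {B : Matrix β γ (MvPolynomial (Fin n) k)}
    (hA : GradedMat r s A) (hB : GradedMat s t B) : GradedMat r t (A * B) := fun i j => by
  rw [Matrix.mul_apply]
  refine Submodule.sum_mem _ fun l _ => ?_
  have := mul_mem_polyPiece (hA i l) (hB l j)
  rwa [show s l - r i + (t j - s l) = t j - r i by ring] at this

theorem GradedMat.sub {r : α → ℤ} {s : β → ℤ} {A B : Matrix α β (MvPolynomial (Fin n) k)}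
    (hA : GradedMat r s A) (hB : GradedMat r s B) : GradedMat r s (A - B) := fun i j =>
  Submodule.sub_mem _ (hA i j) (hB i j)

theorem GradedMat.neg {r : α → ℤ} {s : β → ℤ} {A : Matrix α β (MvPolynomial (Fin n) k)}
    (hA : GradedMat r s A) : GradedMat r s (-A) := fun i j => Submodule.neg_mem _ (hA i j)

theorem GradedMat.zero {r : α → ℤ} {s : β → ℤ} :
    GradedMat r s (0 : Matrix α β (MvPolynomial (Fin n) k)) := fun _ _ => Submodule.zero_mem _

theorem GradedMat.transpose {r : α → ℤ} {s : β → ℤ} {r' : β → ℤ} {s' : α → ℤ}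
    {A : Matrix α β (MvPolynomial (Fin n) k)} (hA : GradedMat r s A)
    (h : ∀ i j, s' i - r' j = s j - r i) : GradedMat r' s' A.transpose := fun i j => by
  rw [h j i]; exact hA j i

/-- The part of degree `0` of a matrix. -/
noncomputable def matComp (r : α → ℤ) (c : β → ℤ) (A : Matrix α β (MvPolynomial (Fin n) k)) :
    Matrix α β (MvPolynomial (Fin n) k) :=
  Matrix.of fun i j => polyComp (c j - r i) (A i j)

theorem gradedMat_matComp (r : α → ℤ) (c : β → ℤ) (A : Matrix α β (MvPolynomial (Fin n) k)) :
    GradedMat r c (matComp r c A) := fun _ _ => polyComp_mem _ _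

theorem matComp_eq_self {r : α → ℤ} {c : β → ℤ} {A : Matrix α β (MvPolynomial (Fin n) k)}
    (hA : GradedMat r c A) : matComp r c A = A := by
  ext1 i j
  simp [matComp, polyComp_of_mem (hA i j)]

theorem mul_matComp [Fintype β] {r : α → ℤ} {s : β → ℤ} (t : γ → ℤ)
    {A : Matrix α β (MvPolynomial (Fin n) k)} (hA : GradedMat r s A)
    (B : Matrix β γ (MvPolynomial (Fin n) k)) : A * matComp s t B = matComp r t (A * B) := by
  ext1 i j
  simp only [Matrix.mul_apply, matComp, Matrix.of_apply, map_sum]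
  refine Finset.sum_congr rfl fun l _ => ?_
  rw [polyComp_mul (hA i l), show t j - r i - (s l - r i) = t j - s l by ring]

/-- Multiplication by a homogeneous matrix commutes with taking degree-0 parts, so the degree-0 part
of any solution is again a solution. -/
theorem exists_gradedMat_mul_eq [Fintype β] {r : α → ℤ} {s : β → ℤ} {t : γ → ℤ}
    {A : Matrix α β (MvPolynomial (Fin n) k)} (hA : GradedMat r s A)
    {Y : Matrix α γ (MvPolynomial (Fin n) k)} (hY : GradedMat r t Y)
    (h : ∃ X : Matrix β γ (MvPolynomial (Fin n) k), A * X = Y) :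
    ∃ X : Matrix β γ (MvPolynomial (Fin n) k), GradedMat s t X ∧ A * X = Y := by
  obtain ⟨X, rfl⟩ := h
  exact ⟨matComp s t X, gradedMat_matComp _ _ _, by rw [mul_matComp t hA, matComp_eq_self hY]⟩

end GradedMatrices

/-! ### Complexes of graded free modules and the chase in a double complex. -/

section Complexes

/-- A complex `⋯ → F_2 → F_1 → F_0` of finite graded free modules over `k[x_1, …, x_n]`. -/
structure GradedComplex (k : Type u) [Field k] (n : ℕ) where
  ι : ℕ → Type
  fin : ∀ p, Fintype (ι p)
  deg : ∀ p, ι p → ℤ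
  D : ∀ p, Matrix (ι p) (ι (p + 1)) (MvPolynomial (Fin n) k)
  graded : ∀ p, GradedMat (deg p) (deg (p + 1)) (D p)
  sq : ∀ p, D p * D (p + 1) = 0

namespace GradedComplex

variable {k : Type u} [Field k] {n : ℕ}

instance (C : GradedComplex k n) (p : ℕ) : Fintype (C.ι p) := C.fin p

/-- The columns of a matrix are cycles. -/
def IsCycle (C : GradedComplex k n) {β : Type*} :
    ∀ p, Matrix (C.ι p) β (MvPolynomial (Fin n) k) → Prop
  | 0, _ => True
  | p + 1, U => C.D p * U = 0

variable (C : GradedComplex k n) {β γ : Type*}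

theorem isCycle_D_mul (p : ℕ) (W : Matrix (C.ι (p + 1)) β (MvPolynomial (Fin n) k)) :
    C.IsCycle p (C.D p * W) := by
  cases p with
  | zero => trivial
  | succ p => simp only [IsCycle]; rw [← Matrix.mul_assoc, C.sq, Matrix.zero_mul]

variable {C} in
theorem IsCycle.mul {p : ℕ} [Fintype β] {U : Matrix (C.ι p) β (MvPolynomial (Fin n) k)}
    (hU : C.IsCycle p U) (A : Matrix β γ (MvPolynomial (Fin n) k)) : C.IsCycle p (U * A) := by
  cases p with
  | zero => trivial
  | succ p =>
    simp only [IsCycle] at hU ⊢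
    rw [← Matrix.mul_assoc, hU, Matrix.zero_mul]

variable {C} in
theorem IsCycle.sub {p : ℕ} {U V : Matrix (C.ι p) β (MvPolynomial (Fin n) k)}
    (hU : C.IsCycle p U) (hV : C.IsCycle p V) : C.IsCycle p (U - V) := by
  cases p with
  | zero => trivial
  | succ p =>
    simp only [IsCycle] at hU hV ⊢
    rw [Matrix.mul_sub, hU, hV, sub_zero]

variable {C} in
theorem IsCycle.submatrix {p : ℕ} {U : Matrix (C.ι p) β (MvPolynomial (Fin n) k)}
    (hU : C.IsCycle p U) (g : γ → β) : C.IsCycle p (U.submatrix id g) := by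
  cases p with
  | zero => trivial
  | succ p =>
    simp only [IsCycle] at hU ⊢
    ext1 i j
    exact congrFun (congrFun hU i) (g j)

/-- The homology in homological degree `p` vanishes in internal degree `e`. -/
def VanishAt (p : ℕ) (e : ℤ) : Prop :=
  ∀ v : Matrix (C.ι p) Unit (MvPolynomial (Fin n) k), GradedMat (C.deg p) (fun _ => e) v →
    C.IsCycle p v →
    ∃ w : Matrix (C.ι (p + 1)) Unit (MvPolynomial (Fin n) k), C.D p * w = v

variable {C}

/-- Columns are lifted one at a time. `VanishAt` promises no homogeneity of the lift, which is
recovered by passing to the degree-0 part. -/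
theorem exists_lift {p : ℕ} {s : β → ℤ} (h : ∀ b, C.VanishAt p (s b))
    {V : Matrix (C.ι p) β (MvPolynomial (Fin n) k)} (hV : GradedMat (C.deg p) s V)
    (hc : C.IsCycle p V) : 
    ∃ W : Matrix (C.ι (p + 1)) β (MvPolynomial (Fin n) k),
      GradedMat (C.deg (p + 1)) s W ∧ C.D p * W = V := by
  refine exists_gradedMat_mul_eq (C.graded p) hV ?_
  choose w hw using fun b => h b (V.submatrix id fun _ => b) (fun i _ => hV i b) (hc.submatrix _)
  refine ⟨Matrix.of fun i b => w b i (), ?_⟩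
  ext1 i b
  exact congrFun (congrFun (hw b) i) ()

/-- An element of total degree `e` of `K_p ⊗ G_q` is encoded as a matrix with rows indexed by the
basis of `K_p` and columns by that of `G_q`, the columns having degree `e - deg`. The differential
of `K` is then left multiplication, and that of `G` is right multiplication by the transpose. This
is lifting in the `G` direction. -/
theorem exists_lift_transpose {p : ℕ} {r : β → ℤ} {e : ℤ} (h : ∀ b, C.VanishAt p (e - r b))
    {V : Matrix β (C.ι p) (MvPolynomial (Fin n) k)} (hV : GradedMat r (fun a => e - C.deg p a) V)
    (hc : C.IsCycle p V.transpose) :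
    ∃ W : Matrix β (C.ι (p + 1)) (MvPolynomial (Fin n) k),
      GradedMat r (fun a => e - C.deg (p + 1) a) W ∧ W * (C.D p).transpose = V := by
  obtain ⟨W, hW, h⟩ := exists_lift h (hV.transpose (fun i j => by ring)) hc
  refine ⟨W.transpose, hW.transpose (fun i j => by ring), ?_⟩
  rw [← Matrix.transpose_mul, h, Matrix.transpose_transpose]

theorem gradedMat_transpose_D (p : ℕ) (e : ℤ) :
    GradedMat (fun a => e - C.deg (p + 1) a) (fun a => e - C.deg p a) (C.D p).transpose :=
  (C.graded p).transpose fun i j => by ring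

/-- In the double complex `K ⊗ G`, correct an element of `K_p ⊗ G_{q+1}` whose image in
`K_p ⊗ G_q` is a cycle of `K` to a cycle of `K`. -/
theorem exists_isCycle_sub (K G : GradedComplex k n) (e : ℤ) (hG : ∀ p d, G.VanishAt (p + 1) d) (p : ℕ) :
    ∀ q, (∀ p' j, p' + j + 1 = p → ∀ a : G.ι (q + 2 + j), K.VanishAt p' (e - G.deg _ a)) →
    ∀ U : Matrix (K.ι p) (G.ι (q + 1)) (MvPolynomial (Fin n) k),
      GradedMat (K.deg p) (fun a => e - G.deg _ a) U → K.IsCycle p (U * (G.D q).transpose) →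
      ∃ V : Matrix (K.ι p) (G.ι (q + 2)) (MvPolynomial (Fin n) k),
        GradedMat (K.deg p) (fun a => e - G.deg _ a) V ∧
          K.IsCycle p (U - V * (G.D (q + 1)).transpose) := by
  induction p with
  -- In homological degree 0 every element counts as a cycle, so no correction is needed.
  | zero => intro q _ U _ _; exact ⟨0, GradedMat.zero, trivial⟩
  | succ p ih =>
    intro q hK U hU hc
    -- The `K`-differential of `U` dies in `G_q` by `hc`, so exactness of `G` lifts it to `W` over
    -- `G_{q+2}`.
    obtain ⟨W, hW, hWU⟩ := exists_lift_transpose (C := G) (p := q + 1) (fun b => hG q _)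
      ((K.graded p).mul hU) (by
        simp only [IsCycle] at hc ⊢
        rw [← Matrix.mul_assoc] at hc
        rw [← Matrix.transpose_transpose (G.D q), ← Matrix.transpose_mul, hc,
          Matrix.transpose_zero])
    -- The image of `W` over `G_{q+1}` is a `K`-boundary, hence a cycle: the same problem, one step
    -- lower in `K` and one step higher in `G`.
    obtain ⟨W', hW', hc'⟩ := ih (q + 1) (fun p' j hj a => by
        have := hK p' (j + 1) (by omega)
        rw [show q + 2 + (j + 1) = q + 1 + 2 + j by ring] at this
        exact this a) W hW (by rw [hWU]; exact K.isCycle_D_mul p U)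
    -- The corrected `W` is a cycle of `K` in degrees where the homology vanishes. A lift `V` of it
    -- corrects `U`, since the term with `W'` is killed by two consecutive differentials of `G`.
    obtain ⟨V, hV, hVW⟩ := exists_lift (C := K) (fun a => hK p 0 rfl a)
      (hW.sub (hW'.mul (G.gradedMat_transpose_D _ e))) hc'
    refine ⟨V, hV, ?_⟩
    simp only [IsCycle]
    rw [Matrix.mul_sub, ← Matrix.mul_assoc, hVW, Matrix.sub_mul, hWU, Matrix.mul_assoc,
      ← Matrix.transpose_mul, G.sq, Matrix.transpose_zero, Matrix.mul_zero, sub_zero, sub_self]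

end GradedComplex
end Complexes


/-! ### Vanishing of homology and regularity bounds from the chase. -/

/-- The kernel of the homogeneous matrix `P`, whose columns have the degrees `s`, is generated by
elements of degree `≤ t`. -/
def SyzygiesGeneratedBy {k : Type*} [Field k] {n : ℕ} {α β : Type*} [Fintype β] (s : β → ℤ)
    (P : Matrix α β (MvPolynomial (Fin n) k)) (t : ℕ) : Prop :=
  ∀ e : ℤ, t < e → ∀ z : Matrix β Unit (MvPolynomial (Fin n) k),
    GradedMat s (fun _ => e) z → P * z = 0 →
    z ∈ Submodule.span (MvPolynomial (Fin n) k)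
      {y : Matrix β Unit (MvPolynomial (Fin n) k) | P * y = 0 ∧
        ∃ e' < e, GradedMat s (fun _ => e') y}

namespace GradedComplex

variable {k : Type u} [Field k] {n : ℕ}

/-- If `G_0` has a single basis element and all the coordinates of the cycle `v ∈ K_p` are images
of elements of `G_1`, then `v` is a combination of cycles with coefficients in the matrix of
`G_1 → G_0`. -/
theorem exists_cycles_eq_sum (K G : GradedComplex k n) [Unique (G.ι 0)]
    (hdeg0 : G.deg 0 default = 0) (hG : ∀ p d, G.VanishAt (p + 1) d) (p : ℕ) (e : ℤ)
    (h0 : ∀ b, G.VanishAt 0 (e - K.deg p b))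
    (hK : ∀ p' j, p' + j + 1 = p → ∀ a : G.ι (0 + 2 + j), K.VanishAt p' (e - G.deg _ a))
    (v : Matrix (K.ι p) Unit (MvPolynomial (Fin n) k))
    (hv : GradedMat (K.deg p) (fun _ => e) v) (hc : K.IsCycle p v) :
    ∃ y : G.ι 1 → Matrix (K.ι p) Unit (MvPolynomial (Fin n) k),
      (∀ a, K.IsCycle p (y a)) ∧ (∀ a, GradedMat (K.deg p) (fun _ => e - G.deg 1 a) (y a)) ∧
      v = ∑ a, G.D 0 default a • y a := by
  obtain ⟨U, hU, hUv⟩ := exists_lift_transpose (C := G) (p := 0) h0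
    (V := v.submatrix id fun _ => ()) (fun i j => by
      change v i () ∈ polyPiece k n (e - G.deg 0 j - K.deg p i)
      rw [Unique.eq_default j, hdeg0, sub_zero]
      exact hv i ()) trivial
  -- The correction comes from `G_2`, so it does not change the image `v` in `G_0`.
  obtain ⟨V, hV, hVU⟩ := exists_isCycle_sub K G e hG p 0 hK U hU (by
    rw [hUv]; exact hc.submatrix _)
  refine ⟨fun a => (U - V * (G.D (0 + 1)).transpose).submatrix id fun _ => a,
    fun a => hVU.submatrix _, fun a i j => ?_, ?_⟩
  · exact (hU.sub (hV.mul (G.gradedMat_transpose_D _ e))) i a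
  · have h : (U - V * (G.D (0 + 1)).transpose) * (G.D 0).transpose = v.submatrix id fun _ => () := by
      rw [Matrix.sub_mul, hUv, Matrix.mul_assoc, ← Matrix.transpose_mul, G.sq,
        Matrix.transpose_zero, Matrix.mul_zero, sub_zero]
    ext1 i j
    have := congrFun (congrFun h i) default
    rw [Matrix.mul_apply, Matrix.submatrix_apply, id] at this
    rw [Matrix.sum_apply, show j = () from rfl, ← this]
    exact Finset.sum_congr rfl fun a _ => mul_comm _ _

/-- Let `G` be a graded free resolution of `k[x_1, …, x_n] / I`, where this quotient vanishes in
degrees `> r`, and let `K` be a complex whose homology is annihilated by `I`. -/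
theorem vanishAt_of_resolution (K G : GradedComplex k n) [Unique (G.ι 0)] {r c : ℕ}
    (hdeg0 : G.deg 0 default = 0) (hG : ∀ p d, G.VanishAt (p + 1) d)
    (h0 : ∀ e, (r : ℤ) < e → G.VanishAt 0 e)
    (hdeg : ∀ q a, G.deg (q + 2) a ≤ (q + 1) * c) (hrc : r + 1 ≤ c)
    (hKdeg : ∀ p a, K.deg p a ≤ p * (r + 1))
    (hKI : ∀ p (v : Matrix (K.ι p) Unit (MvPolynomial (Fin n) k)), K.IsCycle p v → ∀ a,
      ∃ w : Matrix (K.ι (p + 1)) Unit (MvPolynomial (Fin n) k),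
        K.D p * w = G.D 0 default a • v) (i : ℕ) :
    ∀ e, (r + c * i : ℤ) < e → K.VanishAt i e := by
  induction i using Nat.strong_induction_on with
  | _ i ih =>
  intro e he v hv hc
  have hrc' : (r : ℤ) + 1 ≤ c := by exact_mod_cast hrc
  -- The coordinates of `v` have degree above `r` because `r + 1 ≤ c`. The induction hypothesis
  -- applies at `p' = i - (j + 1)`: lowering the degree by at most `(j + 1) * c` matches the drop in
  -- the bound `r + c * i`.
  obtain ⟨y, hy, -, rfl⟩ := exists_cycles_eq_sum K G hdeg0 hG i e
    (fun b => h0 _ (by nlinarith [hKdeg i b])) (fun p' j hj a => by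
      have h2 : G.deg _ a ≤ (j + 1) * c := by
        revert a
        rw [show 0 + 2 + j = j + 2 by ring]
        exact hdeg j
      refine ih p' (by omega) _ ?_
      have hi : (i : ℤ) = p' + j + 1 := by exact_mod_cast hj.symm
      rw [hi] at he
      linarith) v hv hc
  choose w hw using fun a => hKI i (y a) (hy a) a
  refine ⟨∑ a, w a, ?_⟩
  rw [Matrix.mul_sum]
  exact Finset.sum_congr rfl fun a _ => hw a

/-- If `B / I` vanishes in degrees `> r`, then the syzygies of its graded free resolution `G` are
generated in the degrees given by regularity. Here `X` is a linear resolution of `k`. -/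
theorem syzygiesGeneratedBy_of_linear (X G : GradedComplex k n) [Unique (X.ι 0)] {r q : ℕ}
    (hX : ∀ p d, X.VanishAt (p + 1) d) (hX0 : ∀ e, 0 < e → X.VanishAt 0 e)
    (hXdeg : ∀ p a, X.deg p a = p) (hG : ∀ p d, G.VanishAt (p + 1) d)
    (h0 : ∀ e, (r : ℤ) < e → G.VanishAt 0 e)
    (hdeg : ∀ a, G.deg (q + 1) a ≤ r + q + 1) : 
    SyzygiesGeneratedBy (G.deg (q + 1)) (G.D q) (r + q + 2) := by
  intro e he z hz hc
  push_cast at he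
  -- The resolution `G` now plays the part of `K`. Its only homology is at `p' = 0`, where `j = q`
  -- and the relevant degree `e - (q + 2)` exceeds `r`.
  obtain ⟨y, hy, hgr, rfl⟩ := exists_cycles_eq_sum G X (by simpa using hXdeg 0 default) hX (q + 1) e
    (fun b => hX0 _ (by linarith [hdeg b])) (fun p' j hj a => by
      rcases p' with _ | p'
      · refine h0 _ ?_
        rw [hXdeg]
        push_cast
        omega
      · exact hG _ _) z hz hc
  refine Submodule.sum_mem _ fun a _ => Submodule.smul_mem _ _ (Submodule.subset_span ?_)
  exact ⟨hy a, e - X.deg 1 a, by rw [hXdeg]; simp, hgr a⟩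

/-- The bound on one module of `G` makes its syzygies generated in degrees one higher, and `hmin`
turns this into the bound on the next module. -/
theorem deg_le_of_linear (X G : GradedComplex k n) [Unique (X.ι 0)] {r : ℕ}
    (hX : ∀ p d, X.VanishAt (p + 1) d) (hX0 : ∀ e, 0 < e → X.VanishAt 0 e)
    (hXdeg : ∀ p a, X.deg p a = p) (hG : ∀ p d, G.VanishAt (p + 1) d)
    (h0 : ∀ e, (r : ℤ) < e → G.VanishAt 0 e) (hdeg1 : ∀ a, G.deg 1 a ≤ r + 1)
    (hmin : ∀ q t, SyzygiesGeneratedBy (G.deg (q + 1)) (G.D q) t → ∀ a, G.deg (q + 2) a ≤ t) (q : ℕ) :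
    ∀ a, G.deg (q + 1) a ≤ r + q + 1 := by
  induction q with
  | zero => simpa using hdeg1
  | succ q ih =>
    intro a
    have := hmin q _ (syzygiesGeneratedBy_of_linear X G hX hX0 hXdeg hG h0 ih) a
    push_cast at this ⊢
    linarith

end GradedComplex


/-! ### Mapping cones and the linear resolution of the residue field. -/

section ConeMatrices

variable {R l m p q : Type*} [CommRing R] [Fintype m]

theorem fromCols_smul_one_mul_fromRows [Fintype l] [DecidableEq l] (A : Matrix l m R) (x : R) (a : Matrix m q R)
    (b : Matrix l q R) :
    Matrix.fromCols A (x • (1 : Matrix l l R)) * Matrix.fromRows a b = A * a + x • b := by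
  rw [Matrix.fromCols_mul_fromRows, Matrix.smul_mul, Matrix.one_mul]

theorem fromBlocks_smul_one_mul_fromRows [Fintype p] [DecidableEq m] (A : Matrix m p R) (B : Matrix l m R) (x : R)
    (a : Matrix p q R) (b : Matrix m q R) :
    Matrix.fromBlocks A (x • (1 : Matrix m m R)) 0 (-B) * Matrix.fromRows a b =
      Matrix.fromRows (A * a + x • b) (-(B * b)) := by
  rw [Matrix.fromBlocks_mul_fromRows, Matrix.smul_mul, Matrix.one_mul, Matrix.zero_mul, zero_add,
    Matrix.neg_mul]

theorem fromCols_mul_fromBlocks_cone [Fintype l] [DecidableEq l] [DecidableEq m] {A : Matrix l m R} {A' : Matrix m p R} (h : A * A' = 0)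
    (x : R) : Matrix.fromCols A (x • (1 : Matrix l l R)) *
      Matrix.fromBlocks A' (x • (1 : Matrix m m R)) 0 (-A) = 0 := by
  rw [Matrix.fromCols_mul_fromBlocks, h, Matrix.mul_zero, Matrix.mul_smul, Matrix.smul_mul,
    Matrix.mul_one, Matrix.one_mul, smul_neg, add_neg_cancel, zero_add, Matrix.fromCols_zero]

theorem fromBlocks_mul_fromBlocks_cone [Fintype l] [DecidableEq l] [DecidableEq m] {A₀ : Matrix q l R} {A : Matrix l m R} {A' : Matrix m p R}
    (h₀ : A₀ * A = 0) (h : A * A' = 0) (x : R) :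
    Matrix.fromBlocks A (x • (1 : Matrix l l R)) 0 (-A₀) *
      Matrix.fromBlocks A' (x • (1 : Matrix m m R)) 0 (-A) = 0 := by
  rw [Matrix.fromBlocks_multiply, h, Matrix.mul_zero, Matrix.mul_smul, Matrix.smul_mul,
    Matrix.mul_one, Matrix.one_mul, smul_neg, add_neg_cancel, Matrix.mul_neg, Matrix.neg_mul, Matrix.neg_mul,
    h₀, neg_neg,
    Matrix.mul_zero, Matrix.zero_mul, Matrix.zero_mul, neg_zero, add_zero, add_zero,
    add_zero, Matrix.fromBlocks_zero]

end ConeMatrices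

namespace GradedComplex

variable {k : Type u} [Field k] {n : ℕ}

/-- The basis of the mapping cone. -/
def coneι (C : GradedComplex k n) : ℕ → Type
  | 0 => C.ι 0
  | p + 1 => C.ι (p + 1) ⊕ C.ι p

instance coneFintype (C : GradedComplex k n) : ∀ p, Fintype (C.coneι p)
  | 0 => C.fin 0
  | p + 1 => inferInstanceAs (Fintype (C.ι (p + 1) ⊕ C.ι p))

/-- The degrees of the basis of the mapping cone. -/
def coneDeg (C : GradedComplex k n) : ∀ p, C.coneι p → ℤ
  | 0 => C.deg 0
  | p + 1 => Sum.elim (C.deg (p + 1)) fun a => C.deg p a + 1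

open Classical in
/-- The differential of the mapping cone of multiplication by `x`. -/
noncomputable def coneD (C : GradedComplex k n) (x : MvPolynomial (Fin n) k) :
    ∀ p, Matrix (C.coneι p) (C.coneι (p + 1)) (MvPolynomial (Fin n) k)
  | 0 => Matrix.fromCols (C.D 0) (x • (1 : Matrix (C.ι 0) (C.ι 0) (MvPolynomial (Fin n) k)))
  | p + 1 => Matrix.fromBlocks (C.D (p + 1))
      (x • (1 : Matrix (C.ι (p + 1)) (C.ι (p + 1)) (MvPolynomial (Fin n) k))) 0 (-C.D p)

theorem gradedMat_smul_one {α : Type*} [DecidableEq α] (d : α → ℤ) {x : MvPolynomial (Fin n) k}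
    (hx : x ∈ polyPiece k n 1) :
    GradedMat d (fun a => d a + 1) (x • (1 : Matrix α α (MvPolynomial (Fin n) k))) := fun i j => by
  rw [Matrix.smul_apply, Matrix.one_apply]
  split_ifs with h
  · subst h
    simpa using hx
  · simp

/-- The mapping cone of multiplication by a form `x` of degree `1`. -/
noncomputable def cone (C : GradedComplex k n) {x : MvPolynomial (Fin n) k}
    (hx : x ∈ polyPiece k n 1) : GradedComplex k n where
  ι := C.coneι
  fin := C.coneFintype
  deg := C.coneDeg
  D := C.coneD x
  graded p := by
    classical
    cases p with
    | zero =>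
      rintro i (j | j)
      · exact C.graded 0 i j
      · have := gradedMat_smul_one (C.deg 0) hx i j
        convert! this
    | succ p =>
      rintro (i | i) (j | j)
      · exact C.graded (p + 1) i j
      · have := gradedMat_smul_one (C.deg (p + 1)) hx i j
        convert! this
      · exact Submodule.zero_mem _
      · have := (C.graded p).neg i j
        change _ ∈ polyPiece k n (C.deg (p + 1) j + 1 - (C.deg p i + 1))
        rwa [add_sub_add_right_eq_sub]
  sq p := by
    classical
    cases p with
    | zero => exact fromCols_mul_fromBlocks_cone (C.sq 0) x
    | succ p => exact fromBlocks_mul_fromBlocks_cone (C.sq p) (C.sq (p + 1)) x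

theorem cone_D_zero_mul (C : GradedComplex k n) {x : MvPolynomial (Fin n) k}
    (hx : x ∈ polyPiece k n 1) (a : Matrix (C.ι 1) Unit (MvPolynomial (Fin n) k))
    (b : Matrix (C.ι 0) Unit (MvPolynomial (Fin n) k)) :
    (C.cone hx).D 0 *
      (show Matrix ((C.cone hx).ι 1) Unit (MvPolynomial (Fin n) k) from Matrix.fromRows a b) =
    (show Matrix ((C.cone hx).ι 0) Unit (MvPolynomial (Fin n) k) from C.D 0 * a + x • b) := by
  classical
  exact fromCols_smul_one_mul_fromRows _ _ _ _

/-- The homology vanishes in positive homological degrees. -/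
def Acyclic (C : GradedComplex k n) : Prop :=
  ∀ p (v : Matrix (C.ι (p + 1)) Unit (MvPolynomial (Fin n) k)), C.D p * v = 0 →
    ∃ w : Matrix (C.ι (p + 2)) Unit (MvPolynomial (Fin n) k), C.D (p + 1) * w = v

/-- For a cycle `(a, b)` of the cone, `b` is a boundary `D b'`: by acyclicity in higher degrees, and
in the lowest degree because `x` is a nonzerodivisor on the cokernel (`hreg`). Then `a + x b'` is a
cycle of `C`, and a lift of it together with `-b'` bounds `(a, b)`. -/
theorem Acyclic.cone {C : GradedComplex k n} (hC : C.Acyclic) {x : MvPolynomial (Fin n) k}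
    (hx : x ∈ polyPiece k n 1)
    (hreg : ∀ (b : Matrix (C.ι 0) Unit (MvPolynomial (Fin n) k))
      (a : Matrix (C.ι 1) Unit (MvPolynomial (Fin n) k)), C.D 0 * a = x • b →
      ∃ a' : Matrix (C.ι 1) Unit (MvPolynomial (Fin n) k), C.D 0 * a' = b) :
    (C.cone hx).Acyclic := by
  classical
  intro p (v : Matrix (C.ι (p + 1) ⊕ C.ι p) Unit _) hv
  obtain ⟨a, b, rfl⟩ : ∃ (a : Matrix (C.ι (p + 1)) Unit _) (b : Matrix (C.ι p) Unit _),
    v = Matrix.fromRows a b := ⟨_, _, (Matrix.fromRows_toRows v).symm⟩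
  obtain ⟨hab, b', rfl⟩ : C.D p * a = -(x • b) ∧
      ∃ b' : Matrix (C.ι (p + 1)) Unit (MvPolynomial (Fin n) k), C.D p * b' = b := by
    cases p with
    | zero =>
      have h : C.D 0 * a + x • b = 0 := (fromCols_smul_one_mul_fromRows _ _ _ _).symm.trans hv
      have h' := eq_neg_of_add_eq_zero_left h
      refine ⟨h', hreg b (-a) ?_⟩
      rw [Matrix.mul_neg, h', neg_neg]
    | succ p =>
      have h : Matrix.fromRows (C.D (p + 1) * a + x • b) (-(C.D p * b)) = Matrix.fromRows 0 0 :=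
        ((fromBlocks_smul_one_mul_fromRows _ _ _ _ _).symm.trans hv).trans
          Matrix.fromRows_zero.symm
      rw [Matrix.fromRows_ext_iff] at h
      exact ⟨eq_neg_of_add_eq_zero_left h.1, hC p b (neg_eq_zero.mp h.2)⟩
  obtain ⟨a', ha'⟩ := hC p (a + x • b') (by
    rw [Matrix.mul_add, hab, Matrix.mul_smul, neg_add_cancel])
  refine ⟨Matrix.fromRows a' (-b'), (fromBlocks_smul_one_mul_fromRows _ _ _ _ _).trans ?_⟩
  rw [ha', Matrix.mul_neg, neg_neg, smul_neg, add_neg_cancel_right]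

/-- The Koszul complex of no elements. -/
noncomputable def trivialComplex (k : Type u) [Field k] (n : ℕ) : GradedComplex k n where
  ι p := {_u : Unit // p = 0}
  fin _ := inferInstance
  deg p _ := p
  D _ := 0
  graded _ := GradedMat.zero
  sq _ := Matrix.zero_mul _

/-- Membership is decided monomial by monomial, and multiplying by `X i` does not change the
exponents of the variables in `s`. This is the regularity needed for the next cone. -/
theorem mem_span_of_X_mul_mem {s : Set (Fin n)} {i : Fin n} (hi : i ∉ s)
    {p : MvPolynomial (Fin n) k}
    (hp : MvPolynomial.X i * p ∈ Ideal.span (MvPolynomial.X '' s : Set (MvPolynomial (Fin n) k))) :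
    p ∈ Ideal.span (MvPolynomial.X '' s : Set (MvPolynomial (Fin n) k)) := by
  rw [MvPolynomial.mem_ideal_span_X_image] at hp ⊢
  intro d hd
  obtain ⟨j, hj, h⟩ := hp (Finsupp.single i 1 + d) (by
    rw [MvPolynomial.mem_support_iff] at hd ⊢
    rwa [MvPolynomial.coeff_X_mul])
  refine ⟨j, hj, ?_⟩
  rwa [Finsupp.add_apply, Finsupp.single_eq_of_ne (by rintro rfl; exact hi hj), zero_add] at h

/-- The Koszul complex of a set of variables. -/
theorem exists_koszul_variables (k : Type u) [Field k] {n : ℕ} (s : Finset (Fin n)) :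
    ∃ (X : GradedComplex k n) (_ : Unique (X.ι 0)), (∀ p a, X.deg p a = p) ∧ X.Acyclic ∧
      ∀ b : Matrix (X.ι 0) Unit (MvPolynomial (Fin n) k),
        b default () ∈ Ideal.span (MvPolynomial.X '' (s : Set (Fin n))) ↔
          ∃ a : Matrix (X.ι 1) Unit (MvPolynomial (Fin n) k), X.D 0 * a = b := by
  classical
  induction s using Finset.induction_on with
  | empty =>
    refine ⟨trivialComplex k n, ⟨⟨⟨(), rfl⟩⟩, fun _ => rfl⟩, fun _ _ => rfl, ?_, ?_⟩
    · intro p v _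
      refine ⟨0, ?_⟩
      ext1 i
      exact absurd i.2 (Nat.succ_ne_zero p)
    · intro b
      rw [Finset.coe_empty, Set.image_empty, Ideal.span_empty, Ideal.mem_bot]
      constructor
      · intro h
        refine ⟨0, (Matrix.mul_zero _).trans ?_⟩
        ext1 i j
        exact h.symm
      · rintro ⟨a, rfl⟩
        exact congrFun (congrFun (Matrix.zero_mul a) _) _
  | insert i s hi ih =>
    obtain ⟨C, hu, hdeg, hC, hs⟩ := ih
    refine ⟨C.cone (X_mem_polyPiece i), hu, ?_, hC.cone _ ?_, ?_⟩
    · rintro (_ | p) a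
      · exact hdeg 0 a
      · rcases a with a | a
        · exact hdeg (p + 1) a
        · change C.deg p a + 1 = _
          rw [hdeg]
          push_cast
          rfl
    · intro b a hab
      rw [← hs b]
      exact mem_span_of_X_mul_mem (by simpa using hi) ((hs (MvPolynomial.X i • b)).mpr ⟨a, hab⟩)
    · intro b
      rw [Finset.coe_insert, Set.image_insert_eq, Ideal.mem_span_insert]
      constructor
      · rintro ⟨c, z, hz, hb⟩
        obtain ⟨a, ha⟩ := (hs (Matrix.of fun _ _ => z)).mp hz
        refine ⟨_, (C.cone_D_zero_mul (X_mem_polyPiece i) a (Matrix.of fun _ _ => c)).trans ?_⟩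
        rw [ha]
        ext1 l j
        obtain rfl : l = (default : C.ι 0) := Subsingleton.elim (α := C.ι 0) _ _
        refine Eq.trans ?_ hb.symm
        change z + MvPolynomial.X i * c = _
        ring
      · rintro ⟨a, ha⟩
        obtain ⟨a₁, a₂, rfl⟩ : ∃ (a₁ : Matrix (C.ι 1) Unit _) (a₂ : Matrix (C.ι 0) Unit _),
          a = Matrix.fromRows a₁ a₂ := ⟨_, _, (Matrix.fromRows_toRows a).symm⟩
        refine ⟨a₂ default (), (C.D 0 * a₁) default (), (hs _).mpr ⟨_, rfl⟩, ?_⟩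
        have h := congrFun (congrFun (ha.symm.trans
          (C.cone_D_zero_mul (X_mem_polyPiece i) a₁ a₂)) (default : C.ι 0)) ()
        refine h.trans ((add_comm _ _).trans (congrArg (· + _) (mul_comm _ _)))

/-- A linear graded free resolution of `k`. -/
theorem exists_linear_resolution (k : Type u) [Field k] (n : ℕ) :
    ∃ (X : GradedComplex k n) (_ : Unique (X.ι 0)), (∀ p a, X.deg p a = p) ∧
      (∀ p d, X.VanishAt (p + 1) d) ∧ ∀ e, 0 < e → X.VanishAt 0 e := by
  obtain ⟨X, hu, hdeg, hX, h⟩ := exists_koszul_variables k (Finset.univ : Finset (Fin n))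
  refine ⟨X, hu, hdeg, fun p d v _ hc => hX p v hc, fun e he v hv _ => (h v).mp ?_⟩
  have hv' := hv default ()
  rw [hdeg, Nat.cast_zero, sub_zero] at hv'
  lift e to ℕ using he.le
  rw [mem_polyPiece_natCast] at hv'
  rw [MvPolynomial.mem_ideal_span_X_image]
  intro m hm
  have := hv'.degree_eq_sum_deg_support hm
  by_contra! hcon
  have hm0 : m = 0 := Finsupp.ext fun i => hcon i (by simp)
  subst hm0
  simp at this
  omega

end GradedComplex


/-! ### Resolutions by syzygies that are minimal by degree. -/

section Syzygies

variable {k : Type u} [Field k] {n : ℕ}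

theorem polyComp_eq_zero {e : ℤ} {p : MvPolynomial (Fin n) k}
    (h : ∀ i ∈ Finset.range (p.totalDegree + 1), e ≠ i) : polyComp e p = 0 := by
  rw [← sum_polyComp p, map_sum]
  refine Finset.sum_eq_zero fun i hi => ?_
  rw [polyComp_of_mem (polyComp_mem (i : ℤ) p), if_neg (h i hi)]

theorem exists_sum_matComp {β : Type*} [Fintype β] (s : β → ℤ)
    (v : Matrix β Unit (MvPolynomial (Fin n) k)) :
    ∃ E : Finset ℤ, ∑ e ∈ E, matComp s (fun _ => e) v = v := by
  classical
  refine ⟨Finset.univ.biUnion fun a =>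
    (Finset.range ((v a ()).totalDegree + 1)).image fun i : ℕ => (i : ℤ) + s a, ?_⟩
  ext1 a u
  rw [Matrix.sum_apply]
  conv_rhs => rw [← sum_polyComp (v a u)]
  rw [← Finset.sum_subset (Finset.subset_biUnion_of_mem (fun a =>
    (Finset.range ((v a ()).totalDegree + 1)).image fun i : ℕ => (i : ℤ) + s a)
    (Finset.mem_univ a))]
  · rw [Finset.sum_image (by intro i _ j _ h; simpa using h)]
    simp [matComp]
  · intro e _ he
    refine polyComp_eq_zero fun i hi h => he ?_
    exact Finset.mem_image.mpr ⟨i, hi, by simp only [← h]; ring⟩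

/-- A homogeneous matrix has a homogeneous matrix of syzygies which is minimal by degree. -/
theorem exists_syzygies {α β : Type*} [Fintype β] {r : α → ℤ} {s : β → ℤ}
    {P : Matrix α β (MvPolynomial (Fin n) k)} (hP : GradedMat r s P) :
    ∃ (b : ℕ) (t : Fin b → ℤ) (Q : Matrix β (Fin b) (MvPolynomial (Fin n) k)),
      GradedMat s t Q ∧ P * Q = 0 ∧
      (∀ v : Matrix β Unit (MvPolynomial (Fin n) k), P * v = 0 →
        ∃ w : Matrix (Fin b) Unit (MvPolynomial (Fin n) k), Q * w = v) ∧
      ∀ T, SyzygiesGeneratedBy s P T → ∀ a, t a ≤ T := by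
  classical
  let N : Submodule (MvPolynomial (Fin n) k) (Matrix β Unit (MvPolynomial (Fin n) k)) :=
    { carrier := {v | P * v = 0}
      add_mem' := fun {v w} hv hw => by
        change P * (v + w) = 0
        rw [Matrix.mul_add, show P * v = 0 from hv, show P * w = 0 from hw, add_zero]
      zero_mem' := Matrix.mul_zero _
      smul_mem' := fun c v hv => by
        change P * (c • v) = 0
        rw [Matrix.mul_smul, show P * v = 0 from hv, smul_zero] }
  let S : ℕ → Set (Matrix β Unit (MvPolynomial (Fin n) k)) :=
    fun T => {y | P * y = 0 ∧ ∃ e : ℤ, e ≤ T ∧ GradedMat s (fun _ => e) y}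
  have hmono : Monotone S := fun T T' h y ⟨hy, e, he, hg⟩ =>
    ⟨hy, e, he.trans (by exact_mod_cast h), hg⟩
  have hcomp : ∀ v : Matrix β Unit (MvPolynomial (Fin n) k), P * v = 0 → ∀ e, P * matComp s (fun _ => e) v = 0 := fun v hv e => by
    rw [mul_matComp _ hP, hv]
    ext1 i j
    simp [matComp]
  have : IsNoetherian (MvPolynomial (Fin n) k) (Matrix β Unit (MvPolynomial (Fin n) k)) :=
    inferInstanceAs (IsNoetherian (MvPolynomial (Fin n) k) (β → Unit → MvPolynomial (Fin n) k))
  have hex : ∃ T, N ≤ Submodule.span _ (S T) := by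
    obtain ⟨F, hF⟩ := IsNoetherian.noetherian N
    have h1 : ∀ v ∈ N, ∃ T, v ∈ Submodule.span (MvPolynomial (Fin n) k) (S T) := fun v hv => by
      obtain ⟨E, hE⟩ := exists_sum_matComp s v
      refine ⟨E.sup Int.toNat, ?_⟩
      rw [← hE]
      refine Submodule.sum_mem _ fun e he => Submodule.subset_span ⟨hcomp v hv e, e, ?_,
        gradedMat_matComp _ _ _⟩
      have : e.toNat ≤ E.sup Int.toNat := Finset.le_sup he
      omega
    choose! T hT using h1
    refine ⟨F.sup T, ?_⟩
    rw [← hF, Submodule.span_le]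
    intro v hv
    exact Submodule.span_mono (hmono (Finset.le_sup hv)) (hT v (hF ▸ Submodule.subset_span hv))
  -- The hypothesis only lowers the degree of a syzygy above `T`, so the descent is an induction on
  -- the excess over `T`.
  have hgen : ∀ T, SyzygiesGeneratedBy s P T → N ≤ Submodule.span _ (S T) := by
    intro T hT
    have h1 : ∀ (j : ℕ) (e : ℤ), e ≤ T + j →
        ∀ z : Matrix β Unit (MvPolynomial (Fin n) k), P * z = 0 → GradedMat s (fun _ => e) z →
        z ∈ Submodule.span (MvPolynomial (Fin n) k) (S T) := by
      intro j
      induction j with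
      | zero => exact fun e he z hz hg => Submodule.subset_span ⟨hz, e, by simpa using he, hg⟩
      | succ j ih =>
        intro e he z hz hg
        rcases le_or_gt e T with h | h
        · exact Submodule.subset_span ⟨hz, e, h, hg⟩
        · refine (Submodule.span_le.mpr ?_) (hT e h z hg hz)
          rintro y ⟨hy, e', he', hg'⟩
          exact ih e' (by push_cast at he; omega) y hy hg'
    intro v hv
    obtain ⟨E, hE⟩ := exists_sum_matComp s v
    rw [← hE]
    exact Submodule.sum_mem _ fun e _ => h1 (e - T).toNat e (by omega) _ (hcomp v hv e)
      (gradedMat_matComp _ _ _)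
  -- The generators are taken in degrees up to the least possible bound. Only this bound matters;
  -- the family may be redundant.
  obtain ⟨F, hFS, hF⟩ := Submodule.fg_span_iff_fg_span_finset_subset _ |>.mp
    (IsNoetherian.noetherian (Submodule.span (MvPolynomial (Fin n) k) (S (Nat.find hex))))
  have hdeg : ∀ y : F, ∃ e : ℤ, e ≤ Nat.find hex ∧ GradedMat s (fun _ => e) y.1 :=
    fun y => (hFS y.2).2
  choose t ht hgt using hdeg
  refine ⟨F.card, fun a => t (F.equivFin.symm a),
    Matrix.of fun i a => (F.equivFin.symm a).1 i (), ?_, ?_, ?_, ?_⟩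
  · exact fun i a => hgt (F.equivFin.symm a) i ()
  · ext1 i a
    exact congrFun (congrFun (hFS (F.equivFin.symm a).2).1 i) ()
  · intro v hv
    have h1 := hF ▸ Nat.find_spec hex hv
    rw [show (F : Set (Matrix β Unit (MvPolynomial (Fin n) k))) =
      Set.range fun a => (F.equivFin.symm a).1 by
        ext y
        refine ⟨fun hy => ⟨F.equivFin ⟨y, hy⟩, by simp⟩, ?_⟩
        rintro ⟨a, rfl⟩
        exact (F.equivFin.symm a).2] at h1
    obtain ⟨c, hc⟩ := (Submodule.mem_span_range_iff_exists_fun _).mp h1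
    refine ⟨Matrix.of fun a _ => c a, ?_⟩
    rw [← hc]
    ext1 i j
    rw [Matrix.sum_apply, Matrix.mul_apply]
    exact Finset.sum_congr rfl fun a _ => mul_comm _ _
  · intro T hT a
    exact (ht _).trans (by exact_mod_cast Nat.find_min' hex (hgen T hT))

/-- A homogeneous matrix with the degrees of its rows and columns. -/
structure GradedMatrix (k : Type u) [Field k] (n : ℕ) where
  rows : Type
  cols : Type
  finRows : Fintype rows
  finCols : Fintype cols
  rowDeg : rows → ℤ
  colDeg : cols → ℤ
  mat : Matrix rows cols (MvPolynomial (Fin n) k)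
  graded : GradedMat rowDeg colDeg mat

namespace GradedMatrix

instance (M : GradedMatrix k n) : Fintype M.cols := M.finCols

/-- A matrix of syzygies that is minimal by degree. -/
noncomputable def next (M : GradedMatrix k n) : GradedMatrix k n where
  rows := M.cols
  cols := Fin (exists_syzygies M.graded).choose
  finRows := M.finCols
  finCols := inferInstance
  rowDeg := M.colDeg
  colDeg := (exists_syzygies M.graded).choose_spec.choose
  mat := (exists_syzygies M.graded).choose_spec.choose_spec.choose
  graded := (exists_syzygies M.graded).choose_spec.choose_spec.choose_spec.1

/-- Iterated matrices of syzygies. -/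
noncomputable def iter (M : GradedMatrix k n) : ℕ → GradedMatrix k n
  | 0 => M
  | p + 1 => (M.iter p).next

/-- The graded free resolution of the cokernel of a homogeneous matrix. -/
noncomputable def resolution (M : GradedMatrix k n) : GradedComplex k n where
  ι p := (M.iter p).rows
  fin p := (M.iter p).finRows
  deg p := (M.iter p).rowDeg
  D p := (M.iter p).mat
  graded p := (M.iter p).graded
  sq p := (exists_syzygies (M.iter p).graded).choose_spec.choose_spec.choose_spec.2.1

theorem resolution_vanishAt (M : GradedMatrix k n) (p : ℕ) (d : ℤ) :
    M.resolution.VanishAt (p + 1) d := fun v _ hc =>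
  (exists_syzygies (M.iter p).graded).choose_spec.choose_spec.choose_spec.2.2.1 v hc

theorem resolution_minimal (M : GradedMatrix k n) (q t : ℕ)
    (h : SyzygiesGeneratedBy (M.resolution.deg (q + 1)) (M.resolution.D q) t) (a) :
    M.resolution.deg (q + 2) a ≤ t :=
  (exists_syzygies (M.iter q).graded).choose_spec.choose_spec.choose_spec.2.2.2 t h a

end GradedMatrix

end Syzygies


/-! ### The Koszul complex in coordinates. -/

section KoszulMatrices

variable {k : Type u} [Field k] {n m : ℕ}

theorem smul_mem_koszulPiece (deg : Fin m → ℕ) {i : ℕ} {e : ℤ} (s : Fin i → Fin m)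
    {b : MvPolynomial (Fin n) k} (hb : b ∈ polyPiece k n (e - ∑ l, (deg (s l) : ℤ))) :
    b • ExteriorAlgebra.ιMulti (MvPolynomial (Fin n) k) i
      (fun l => (Pi.single (s l) 1 : Fin m → MvPolynomial (Fin n) k)) ∈ koszulPiece k n deg i e :=
  Submodule.subset_span ⟨s, b, hb, rfl⟩

theorem ι_mul_mem_koszulPiece (deg : Fin m → ℕ) {i : ℕ} {e : ℤ} (j : Fin m)
    {x : ExteriorAlgebra (MvPolynomial (Fin n) k) (Fin m → MvPolynomial (Fin n) k)}
    (hx : x ∈ koszulPiece k n deg i e) :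
    ExteriorAlgebra.ι (MvPolynomial (Fin n) k) (Pi.single j 1) * x ∈
      koszulPiece k n deg (i + 1) (e + deg j) := by
  induction hx using Submodule.span_induction with
  | mem x hx =>
    obtain ⟨s, b, hb, rfl⟩ := hx
    have h : (fun l => (Pi.single ((Fin.cons j s : Fin (i + 1) → Fin m) l) 1 :
        Fin m → MvPolynomial (Fin n) k)) =
        Matrix.vecCons (Pi.single j 1) fun l => Pi.single (s l) 1 := by
      ext1 l
      refine Fin.cases ?_ (fun l => ?_) l <;> simp
    have := smul_mem_koszulPiece (k := k) (n := n) deg (e := e + deg j)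
      (Fin.cons j s : Fin (i + 1) → Fin m) (b := b) (by
        rw [Fin.sum_univ_succ]
        simp only [Fin.cons_zero, Fin.cons_succ]
        rwa [add_comm (deg j : ℤ), add_sub_add_right_eq_sub])
    rw [h, ExteriorAlgebra.ιMulti_succ_apply] at this
    simpa [Algebra.mul_smul_comm] using this
  | zero => simp
  | add x y _ _ hx hy => rw [mul_add]; exact Submodule.add_mem _ hx hy
  | smul c x _ hx => rw [mul_smul_comm]; exact Submodule.smul_mem _ _ hx

theorem koszulD_ι_mul (f : Fin m → MvPolynomial (Fin n) k) (j : Fin m)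
    (x : ExteriorAlgebra (MvPolynomial (Fin n) k) (Fin m → MvPolynomial (Fin n) k)) :
    koszulD f (ExteriorAlgebra.ι (MvPolynomial (Fin n) k) (Pi.single j 1) * x) =
      f j • x - ExteriorAlgebra.ι (MvPolynomial (Fin n) k) (Pi.single j 1) * koszulD f x := by
  have h := CliffordAlgebra.contractLeft_ι_mul (Q := 0)
    (Fintype.linearCombination (MvPolynomial (Fin n) k) f) (Pi.single j 1) x
  rw [Fintype.linearCombination_apply_single, one_smul] at h
  exact h

theorem koszulD_algebraMap (f : Fin m → MvPolynomial (Fin n) k) (b : MvPolynomial (Fin n) k) :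
    koszulD f (algebraMap _ _ b) = 0 :=
  CliffordAlgebra.contractLeft_algebraMap (Q := 0) _ b

theorem koszulD_mem_koszulPiece {f : Fin m → MvPolynomial (Fin n) k} {deg : Fin m → ℕ}
    (hf : ∀ j, (f j).IsHomogeneous (deg j)) (i : ℕ) {e : ℤ}
    {x : ExteriorAlgebra (MvPolynomial (Fin n) k) (Fin m → MvPolynomial (Fin n) k)}
    (hx : x ∈ koszulPiece k n deg (i + 1) e) : koszulD f x ∈ koszulPiece k n deg i e := by
  -- By the Leibniz rule the differential of a wedge has two terms; the one with coefficient `b * f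
  -- (s 0)` has the right degree by homogeneity, and `key` reduces the claim to the other.
  have key : ∀ (i : ℕ) (e : ℤ) (s : Fin (i + 1) → Fin m) (b : MvPolynomial (Fin n) k),
      b ∈ polyPiece k n (e - ∑ l, (deg (s l) : ℤ)) →
      ExteriorAlgebra.ι (MvPolynomial (Fin n) k) (Pi.single (s 0) 1) *
        koszulD f (b • ExteriorAlgebra.ιMulti (MvPolynomial (Fin n) k) i
          fun l => (Pi.single (s l.succ) 1 : Fin m → MvPolynomial (Fin n) k)) ∈
        koszulPiece k n deg i e →
      koszulD f (b • ExteriorAlgebra.ιMulti (MvPolynomial (Fin n) k) (i + 1)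
        fun l => (Pi.single (s l) 1 : Fin m → MvPolynomial (Fin n) k)) ∈
        koszulPiece k n deg i e := by
    intro i e s b hb h
    rw [ExteriorAlgebra.ιMulti_succ_apply, map_smul, koszulD_ι_mul, smul_sub, smul_smul]
    refine Submodule.sub_mem _ (smul_mem_koszulPiece deg (fun l => s l.succ) ?_) ?_
    · have := mul_mem_polyPiece hb (mem_polyPiece_natCast.mpr (hf (s 0)))
      rw [Fin.sum_univ_succ] at this
      rwa [show e - ((deg (s 0) : ℤ) + ∑ l : Fin i, (deg (s l.succ) : ℤ)) + (deg (s 0) : ℤ) =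
        e - ∑ l : Fin i, (deg (s l.succ) : ℤ) by ring] at this
    · rwa [map_smul, mul_smul_comm] at h
  induction i generalizing e x with
  | zero =>
    induction hx using Submodule.span_induction with
    | mem x hx =>
      obtain ⟨s, b, hb, rfl⟩ := hx
      refine key 0 e s b hb ?_
      rw [ExteriorAlgebra.ιMulti_zero_apply, ← Algebra.algebraMap_eq_smul_one, koszulD_algebraMap,
        mul_zero]
      exact Submodule.zero_mem _
    | zero => rw [map_zero]; exact Submodule.zero_mem _
    | add x y _ _ hx hy => rw [map_add]; exact Submodule.add_mem _ hx hy
    | smul c x _ hx =>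
      rw [LinearMap.map_smul_of_tower]
      exact Submodule.smul_mem _ _ hx
  | succ i ih =>
    induction hx using Submodule.span_induction with
    | mem x hx =>
      obtain ⟨s, b, hb, rfl⟩ := hx
      refine key (i + 1) e s b hb ?_
      have := ι_mul_mem_koszulPiece deg (s 0) (ih (e := e - deg (s 0))
        (smul_mem_koszulPiece deg (fun l => s l.succ) (b := b) (by
          rwa [Fin.sum_univ_succ, ← sub_sub] at hb)))
      rwa [sub_add_cancel] at this
    | zero => rw [map_zero]; exact Submodule.zero_mem _
    | add x y _ _ hx hy => rw [map_add]; exact Submodule.add_mem _ hx hy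
    | smul c x _ hx =>
      rw [LinearMap.map_smul_of_tower]
      exact Submodule.smul_mem _ _ hx

/-- The basis of `⋀^p (B^m)`. -/
noncomputable def koszulBasis (k : Type u) [Field k] (n m p : ℕ) :
    Module.Basis (Set.powersetCard (Fin m) p) (MvPolynomial (Fin n) k)
      (⋀[MvPolynomial (Fin n) k]^p (Fin m → MvPolynomial (Fin n) k)) :=
  (Pi.basisFun (MvPolynomial (Fin n) k) (Fin m)).exteriorPower p

/-- The degree of a basis element of `⋀^p (B^m)`. -/
noncomputable def koszulDeg (deg : Fin m → ℕ) (p : ℕ) (s : Set.powersetCard (Fin m) p) : ℤ :=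
  ∑ l, (deg (Set.powersetCard.ofFinEmbEquiv.symm s l) : ℤ)

theorem coe_koszulBasis (p : ℕ) (s : Set.powersetCard (Fin m) p) :
    (koszulBasis k n m p s : ExteriorAlgebra _ _) =
      ExteriorAlgebra.ιMulti (MvPolynomial (Fin n) k) p fun l =>
        (Pi.single (Set.powersetCard.ofFinEmbEquiv.symm s l) 1 :
          Fin m → MvPolynomial (Fin n) k) := by
  rw [koszulBasis, exteriorPower.basis_apply]
  simp only [exteriorPower.ιMulti_family_apply_coe, ExteriorAlgebra.ιMulti_family]
  congr 1
  ext1 l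
  simp

/-- If `t` is a permutation of `s`, the degree sums agree and the determinant is a constant;
otherwise every term of its expansion contains a zero entry. -/
theorem det_mem_polyPiece (deg : Fin m → ℕ) {p : ℕ} (s t : Fin p → Fin m) :
    (Matrix.of fun i j => (Pi.single (s i) 1 : Fin m → MvPolynomial (Fin n) k) (t j)).det ∈
      polyPiece k n (∑ l, (deg (s l) : ℤ) - ∑ l, (deg (t l) : ℤ)) := by
  by_cases h : ∃ σ : Equiv.Perm (Fin p), ∀ i, t i = s (σ i)
  · obtain ⟨σ, hσ⟩ := h
    rw [show ∑ l, (deg (t l) : ℤ) = ∑ l, (deg (s l) : ℤ) by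
      simp only [hσ]
      exact Equiv.sum_comp σ fun l => (deg (s l) : ℤ)]
    rw [sub_self]
    rw [show (Matrix.of fun i j => (Pi.single (s i) 1 : Fin m → MvPolynomial (Fin n) k) (t j)) =
      (MvPolynomial.C : k →+* MvPolynomial (Fin n) k).mapMatrix
        (Matrix.of fun i j => (Pi.single (s i) 1 : Fin m → k) (t j)) by
      ext1 i j
      simp [Pi.single_apply, apply_ite], ← RingHom.map_det]
    exact mem_polyPiece_natCast (d := 0).mpr (MvPolynomial.isHomogeneous_C _ _)
  · rw [Matrix.det_apply]
    refine Submodule.sum_mem _ fun (σ : Equiv.Perm (Fin p)) _ => ?_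
    · have : ∃ i, t i ≠ s (σ i) := by
        by_contra! hcon
        exact h ⟨σ, hcon⟩
      obtain ⟨i, hi⟩ := this
      rw [Finset.prod_eq_zero (Finset.mem_univ i), smul_zero]
      · exact Submodule.zero_mem _
      · simp [Pi.single_apply, hi]

/-- The spanning wedges of `koszulPiece` have arbitrary index sequences, while the basis uses
increasing ones; a coordinate of such a wedge is a determinant of Kronecker deltas, controlled by
`det_mem_polyPiece`. -/
theorem koszulBasis_repr_mem (deg : Fin m → ℕ) (p : ℕ) (e : ℤ)
    (x : ⋀[MvPolynomial (Fin n) k]^p (Fin m → MvPolynomial (Fin n) k))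
    (hx : (x : ExteriorAlgebra _ _) ∈ koszulPiece k n deg p e) (s : Set.powersetCard (Fin m) p) :
    (koszulBasis k n m p).repr x s ∈ polyPiece k n (e - koszulDeg deg p s) := by
  have h : koszulPiece k n deg p e ≤
      ((polyPiece k n (e - koszulDeg deg p s)).comap
        (((koszulBasis k n m p).coord s).restrictScalars k)).map
          ((⋀[MvPolynomial (Fin n) k]^p
            (Fin m → MvPolynomial (Fin n) k)).subtype.restrictScalars k) := by
    refine Submodule.span_le.mpr ?_
    rintro _ ⟨t, b, hb, rfl⟩
    refine ⟨b • exteriorPower.ιMulti _ p fun l => Pi.single (t l) 1, ?_, rfl⟩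
    change (koszulBasis k n m p).coord s _ ∈ polyPiece k n (e - koszulDeg deg p s)
    rw [map_smul, koszulBasis, exteriorPower.basis_coord, exteriorPower.ιMultiDual_apply_ιMulti,
      smul_eq_mul]
    have := mul_mem_polyPiece hb (det_mem_polyPiece (k := k) (n := n) deg t
      (Set.powersetCard.ofFinEmbEquiv.symm s))
    rw [sub_add_sub_cancel] at this
    rw [koszulDeg]
    simpa using this
  obtain ⟨y, hy, hyx⟩ := h hx
  obtain rfl : y = x := Subtype.ext hyx
  exact hy

/-- The differential `⋀^(p+1) (B^m) → ⋀^p (B^m)` of the Koszul complex. -/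
noncomputable def koszulDiff (f : Fin m → MvPolynomial (Fin n) k) (p : ℕ) :
    ⋀[MvPolynomial (Fin n) k]^(p + 1) (Fin m → MvPolynomial (Fin n) k)
      →ₗ[MvPolynomial (Fin n) k]
    ⋀[MvPolynomial (Fin n) k]^p (Fin m → MvPolynomial (Fin n) k) :=
  (koszulD f).restrict (koszulD_mem f p)

open Classical in
/-- The Koszul complex on `f` in coordinates. -/
noncomputable def koszulComplex (f : Fin m → MvPolynomial (Fin n) k) (deg : Fin m → ℕ)
    (hf : ∀ j, (f j).IsHomogeneous (deg j)) : GradedComplex k n where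
  ι p := Set.powersetCard (Fin m) p
  fin _ := inferInstance
  deg p := koszulDeg deg p
  D p := LinearMap.toMatrix (koszulBasis k n m (p + 1)) (koszulBasis k n m p) (koszulDiff f p)
  graded p s t := by
    rw [LinearMap.toMatrix_apply]
    refine koszulBasis_repr_mem deg p _ _ (koszulD_mem_koszulPiece hf p ?_) s
    rw [Submodule.subtype_apply, coe_koszulBasis, ← one_smul (MvPolynomial (Fin n) k) (ExteriorAlgebra.ιMulti _ _ _)]
    refine smul_mem_koszulPiece deg _ ?_
    rw [koszulDeg, sub_self]
    exact one_mem_polyPiece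
  sq p := by
    rw [← LinearMap.toMatrix_comp]
    have h : koszulDiff f p ∘ₗ koszulDiff f (p + 1) = 0 := LinearMap.ext fun x =>
      Subtype.ext (CliffordAlgebra.contractLeft_contractLeft (Q := 0) _ x.1)
    rw [h, map_zero]

/-- The coordinates of an element of `⋀^p (B^m)`. -/
noncomputable def koszulCoords (p : ℕ) :
    ⋀[MvPolynomial (Fin n) k]^p (Fin m → MvPolynomial (Fin n) k) →ₗ[MvPolynomial (Fin n) k]
      Matrix (Set.powersetCard (Fin m) p) Unit (MvPolynomial (Fin n) k) where
  toFun x := Matrix.of fun s _ => (koszulBasis k n m p).repr x s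
  map_add' x y := by ext1 s j; simp
  map_smul' c x := by ext1 s j; simp

theorem koszulCoords_injective (p : ℕ) :
    Function.Injective (koszulCoords (k := k) (n := n) (m := m) p) := fun x y h => by
  refine (koszulBasis k n m p).repr.injective (Finsupp.ext fun s => ?_)
  exact congrFun (congrFun h s) ()

theorem koszulCoords_surjective (p : ℕ) :
    Function.Surjective (koszulCoords (k := k) (n := n) (m := m) p) := fun v => by
  refine ⟨(koszulBasis k n m p).equivFun.symm fun s => v s (), ?_⟩
  ext1 s j
  exact congrFun ((koszulBasis k n m p).equivFun.apply_symm_apply fun s => v s ()) s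

variable {f : Fin m → MvPolynomial (Fin n) k} {deg : Fin m → ℕ}
  (hf : ∀ j, (f j).IsHomogeneous (deg j))

theorem koszulComplex_D_mul (p : ℕ)
    (x : ⋀[MvPolynomial (Fin n) k]^(p + 1) (Fin m → MvPolynomial (Fin n) k)) :
    (koszulComplex f deg hf).D p *
      (show Matrix ((koszulComplex f deg hf).ι (p + 1)) Unit _ from koszulCoords (p + 1) x) =
    (show Matrix ((koszulComplex f deg hf).ι p) Unit _ from
      koszulCoords p (koszulDiff f p x)) := by
  classical
  ext1 s j
  have := congrFun (LinearMap.toMatrix_mulVec_repr (koszulBasis k n m (p + 1)) (koszulBasis k n m p)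
    (koszulDiff f p) x) s
  convert! this

theorem koszulComplex_isCycle_iff (p : ℕ)
    (x : ⋀[MvPolynomial (Fin n) k]^p (Fin m → MvPolynomial (Fin n) k)) :
    (koszulComplex f deg hf).IsCycle p (koszulCoords p x) ↔ koszulD f x.1 = 0 := by
  cases p with
  | zero =>
    refine ⟨fun _ => ?_, fun _ => trivial⟩
    obtain ⟨b, hb⟩ : x.1 ∈ (1 : Submodule (MvPolynomial (Fin n) k) (ExteriorAlgebra _ _)) := by
      rw [← pow_zero]
      exact x.2
    rw [← hb]
    rw [LinearMap.toSpanSingleton_apply, ← Algebra.algebraMap_eq_smul_one]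
    exact koszulD_algebraMap f b
  | succ p =>
    have h := koszulComplex_D_mul hf p x
    constructor
    · intro hc
      have h0 : koszulDiff f p x = 0 := koszulCoords_injective p (by
        exact (h.symm.trans hc).trans (map_zero _).symm)
      exact congrArg Subtype.val h0
    · intro hc
      refine h.trans ?_
      have h0 : koszulDiff f p x = 0 := Subtype.ext hc
      rw [h0]
      exact map_zero _

/-- Left multiplication by `e_j` is a homotopy between multiplication by `f j` and zero: on a cycle
`x` one has `d (e_j ∧ x) = f_j x`. -/
theorem koszulComplex_smul_boundary (p : ℕ)
    (v : Matrix ((koszulComplex f deg hf).ι p) Unit (MvPolynomial (Fin n) k))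
    (hv : (koszulComplex f deg hf).IsCycle p v) (j : Fin m) :
    ∃ w : Matrix ((koszulComplex f deg hf).ι (p + 1)) Unit (MvPolynomial (Fin n) k),
      (koszulComplex f deg hf).D p * w = f j • v := by
  obtain ⟨x, rfl⟩ := koszulCoords_surjective p v
  rw [koszulComplex_isCycle_iff] at hv
  have hmem : ExteriorAlgebra.ι (MvPolynomial (Fin n) k) (Pi.single j 1) * x.1 ∈
      ⋀[MvPolynomial (Fin n) k]^(p + 1) (Fin m → MvPolynomial (Fin n) k) := by
    rw [ExteriorAlgebra.exteriorPower, pow_succ']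
    exact Submodule.mul_mem_mul ⟨_, rfl⟩ x.2
  refine ⟨_, (koszulComplex_D_mul hf p ⟨_, hmem⟩).trans ?_⟩
  have h : koszulDiff f p ⟨_, hmem⟩ = f j • x := Subtype.ext <| by
    refine (koszulD_ι_mul f j x.1).trans ?_
    rw [hv, mul_zero, sub_zero]
    rfl
  rw [h]
  exact map_smul _ _ _

theorem koszulHomologyPiece_eq_bot {i : ℕ} {e : ℤ}
    (h : (koszulComplex f deg hf).VanishAt i e) : koszulHomologyPiece f deg i e = ⊥ := by
  rw [eq_bot_iff]
  rintro _ ⟨z, hz, rfl⟩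
  have hz' : z.1 ∈ koszulPiece k n deg i e := hz
  let x : ⋀[MvPolynomial (Fin n) k]^i (Fin m → MvPolynomial (Fin n) k) := ⟨z.1, z.2.2⟩
  obtain ⟨w, hw⟩ := h (koszulCoords i x) (fun s _ => koszulBasis_repr_mem deg i e x hz' s)
    ((koszulComplex_isCycle_iff hf i x).mpr z.2.1)
  obtain ⟨y, rfl⟩ := koszulCoords_surjective (i + 1) w
  have h' : koszulDiff f i y = x :=
    koszulCoords_injective i ((koszulComplex_D_mul hf i y).symm.trans hw)
  refine (Submodule.mem_bot _).mpr ((Submodule.Quotient.mk_eq_zero _).mpr ?_)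
  exact ⟨y.1, y.2, congrArg Subtype.val h'⟩

end KoszulMatrices


/-! ### Degree bounds for the ideal and its resolution, and the case of end zero. -/

section Ideals

variable {k : Type u} [Field k] {n m : ℕ}

theorem mem_of_isHomogeneous_succ {J : Ideal (MvPolynomial (Fin n) k)} {d : ℕ}
    (h : ∀ q : MvPolynomial (Fin n) k, q.IsHomogeneous d → q ∈ J)
    {p : MvPolynomial (Fin n) k} (hp : p.IsHomogeneous (d + 1)) : p ∈ J := by
  rw [p.as_sum]
  refine Submodule.sum_mem _ fun s hs => ?_
  have hdeg : s.degree = d + 1 := by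
    by_contra hne
    exact (MvPolynomial.mem_support_iff.mp hs) (hp.coeff_eq_zero hne)
  obtain ⟨i, hi⟩ : ∃ i, s i ≠ 0 := by
    by_contra! hcon
    rw [show s = 0 from Finsupp.ext hcon, map_zero] at hdeg
    omega
  have hs' : Finsupp.single i 1 + (s - Finsupp.single i 1) = s :=
    add_tsub_cancel_of_le (by simpa [Nat.one_le_iff_ne_zero] using hi)
  rw [← hs', ← one_mul (MvPolynomial.coeff _ p), ← MvPolynomial.monomial_mul]
  refine Ideal.mul_mem_left _ _ (h _ (MvPolynomial.isHomogeneous_monomial _ ?_))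
  rw [← hs', map_add, Finsupp.degree_single] at hdeg
  omega

theorem mem_span_X_of_isHomogeneous {d : ℕ} {p : MvPolynomial (Fin n) k}
    (hp : p.IsHomogeneous (d + 1)) : p ∈ Ideal.span (Set.range MvPolynomial.X) := by
  rw [← Set.image_univ, MvPolynomial.mem_ideal_span_X_image]
  intro s hs
  by_contra! hcon
  rw [show s = 0 from Finsupp.ext fun i => hcon i trivial] at hs
  exact (MvPolynomial.mem_support_iff.mp hs) (hp.coeff_eq_zero (by simp))

theorem quotientPiece_eq_bot_iff {I : Ideal (MvPolynomial (Fin n) k)} {e : ℤ} :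
    quotientPiece I e = ⊥ ↔ ∀ p ∈ polyPiece k n e, p ∈ I := by
  rw [quotientPiece, eq_bot_iff, Submodule.map_le_iff_le_comap]
  refine forall₂_congr fun p _ => ?_
  rw [Submodule.mem_comap, Submodule.mem_bot]
  exact Ideal.Quotient.eq_zero_iff_mem

theorem exists_endQuotient {I : Ideal (MvPolynomial (Fin n) k)} (hI : endQuotient I < ⊤)
    (hne : I ≠ ⊤) : ∃ r : ℕ, endQuotient I = ((r : ℝ) : EReal) ∧
      ∀ e : ℤ, r < e → ∀ p ∈ polyPiece k n e, p ∈ I := by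
  obtain ⟨x, hx, -⟩ := EReal.lt_iff_exists_real_btwn.mp hI
  have hle : ∀ e : ℤ, quotientPiece I e ≠ ⊥ → (e : ℝ) ≤ x := fun e he => by
    have h1 : ((e : ℝ) : EReal) ≤ endQuotient I := le_sSup ⟨e, he, rfl⟩
    exact_mod_cast (h1.trans_lt hx).le
  have h0 : quotientPiece I 0 ≠ ⊥ := fun h =>
    hne ((Ideal.eq_top_iff_one I).mpr (quotientPiece_eq_bot_iff.mp h 1 one_mem_polyPiece))
  obtain ⟨r, hr, hmax⟩ := Int.exists_greatest_of_bdd (P := fun e => quotientPiece I e ≠ ⊥)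
    ⟨⌊x⌋, fun e he => Int.le_floor.mpr (hle e he)⟩ ⟨0, h0⟩
  lift r to ℕ using hmax 0 h0
  refine ⟨r, le_antisymm (sSup_le ?_) (le_sSup ⟨r, hr, by simp⟩), fun e he => ?_⟩
  · rintro _ ⟨e, he, rfl⟩
    have := hmax e he
    rw [EReal.coe_le_coe_iff]
    exact_mod_cast this
  · rw [← quotientPiece_eq_bot_iff]
    by_contra hcon
    exact absurd (hmax e hcon) (not_le.mpr he)

/-- A homogeneous element of an ideal generated by forms has homogeneous coefficients. -/
theorem exists_coeff_of_mem_span {f : Fin m → MvPolynomial (Fin n) k} {deg : Fin m → ℕ}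
    (hf : ∀ j, (f j).IsHomogeneous (deg j)) {p : MvPolynomial (Fin n) k} {e : ℤ}
    (hp : p ∈ polyPiece k n e) (hpI : p ∈ Ideal.span (Set.range f)) :
    ∃ c : Fin m → MvPolynomial (Fin n) k, (∀ j, c j ∈ polyPiece k n (e - deg j)) ∧
      ∑ j, c j * f j = p := by
  obtain ⟨c, hc⟩ := (Submodule.mem_span_range_iff_exists_fun _).mp hpI
  refine ⟨fun j => polyComp (e - deg j) (c j), fun j => polyComp_mem _ _, ?_⟩
  have h := polyComp_of_mem (e := e) hp
  rw [if_pos rfl, ← hc, map_sum] at h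
  rw [← hc, ← h]
  refine Finset.sum_congr rfl fun j _ => ?_
  rw [smul_eq_mul, mul_comm (c j), polyComp_mul (mem_polyPiece_natCast.mpr (hf j)), mul_comm]

/-- By degree reasons the generators of degree at most `r + 1` produce all of `I` in those degrees.
In particular they produce every form of degree `r + 1`, hence every form of higher degree, so they
generate `I` and minimality applies with `c = r + 2`. -/
theorem deg_le_of_isMinimalByDegree {f : Fin m → MvPolynomial (Fin n) k} {deg : Fin m → ℕ}
    (hmin : IsMinimalByDegree f deg) {r : ℕ}
    (hr : ∀ e : ℤ, r < e → ∀ p ∈ polyPiece k n e, p ∈ Ideal.span (Set.range f)) (j : Fin m) :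
    deg j ≤ r + 1 := by
  have hlow : ∀ d ≤ r + 1, ∀ p : MvPolynomial (Fin n) k, p.IsHomogeneous d →
      p ∈ Ideal.span (Set.range f) → p ∈ Ideal.span (f '' {j | deg j < r + 2}) := by
    intro d hd p hp hpI
    obtain ⟨c, hc, rfl⟩ := exists_coeff_of_mem_span hmin.homogeneous
      (mem_polyPiece_natCast.mpr hp) hpI
    refine Submodule.sum_mem _ fun j _ => ?_
    by_cases hj : deg j < r + 2
    · exact Ideal.mul_mem_left _ _ (Ideal.subset_span ⟨j, hj, rfl⟩)
    · rw [eq_zero_of_mem_polyPiece_neg (by omega) (hc j), zero_mul]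
      exact Submodule.zero_mem _
  have hhigh : ∀ d, ∀ p : MvPolynomial (Fin n) k, p.IsHomogeneous (r + 1 + d) →
      p ∈ Ideal.span (f '' {j | deg j < r + 2}) := by
    intro d
    induction d with
    | zero =>
      intro p hp
      exact hlow _ le_rfl p hp (hr (r + 1 : ℕ) (by push_cast; omega) p
        (mem_polyPiece_natCast.mpr hp))
    | succ d ih => exact fun p hp => mem_of_isHomogeneous_succ ih hp
  refine Nat.lt_succ_iff.mp (hmin.minimal (r + 2) (le_antisymm
    (Ideal.span_mono (Set.image_subset_range _ _)) (Ideal.span_le.mpr ?_)) j)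
  rintro _ ⟨j, rfl⟩
  rcases le_or_gt (deg j) (r + 1) with h | h
  · exact hlow _ h _ (hmin.homogeneous j) (Ideal.subset_span ⟨j, rfl⟩)
  · refine hhigh (deg j - (r + 1)) _ ?_
    rw [Nat.add_sub_cancel' h.le]
    exact hmin.homogeneous j

/-- The row of generators of an ideal. -/
noncomputable def generatorMatrix (f : Fin m → MvPolynomial (Fin n) k) (deg : Fin m → ℕ)
    (hf : ∀ j, (f j).IsHomogeneous (deg j)) : GradedMatrix k n where
  rows := Unit
  cols := Fin m
  finRows := inferInstance
  finCols := inferInstance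
  rowDeg _ := 0
  colDeg j := deg j
  mat := Matrix.of fun _ j => f j
  graded _ j := by
    rw [sub_zero]
    exact mem_polyPiece_natCast.mpr (hf j)

instance uniqueResolutionZero (f : Fin m → MvPolynomial (Fin n) k) (deg : Fin m → ℕ)
    (hf : ∀ j, (f j).IsHomogeneous (deg j)) :
    Unique ((generatorMatrix f deg hf).resolution.ι 0) :=
  inferInstanceAs (Unique Unit)

variable {f : Fin m → MvPolynomial (Fin n) k} {deg : Fin m → ℕ}
  (hf : ∀ j, (f j).IsHomogeneous (deg j))

theorem koszulComplex_smul_boundary_of_mem (p : ℕ)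
    (v : Matrix ((koszulComplex f deg hf).ι p) Unit (MvPolynomial (Fin n) k))
    (hv : (koszulComplex f deg hf).IsCycle p v) {b : MvPolynomial (Fin n) k}
    (hb : b ∈ Ideal.span (Set.range f)) :
    ∃ w : Matrix ((koszulComplex f deg hf).ι (p + 1)) Unit (MvPolynomial (Fin n) k),
      (koszulComplex f deg hf).D p * w = b • v := by
  obtain ⟨c, rfl⟩ := (Submodule.mem_span_range_iff_exists_fun _).mp hb
  choose w hw using koszulComplex_smul_boundary hf p v hv
  refine ⟨∑ j, c j • w j, ?_⟩
  rw [Matrix.mul_sum, Finset.sum_smul]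
  refine Finset.sum_congr rfl fun j _ => ?_
  rw [Matrix.mul_smul, hw, smul_smul, smul_eq_mul]

theorem koszulDeg_le {d : ℕ} (hd : ∀ j, deg j ≤ d) (p : ℕ) (s : Set.powersetCard (Fin m) p) :
    koszulDeg deg p s ≤ p * d := by
  refine (Finset.sum_le_card_nsmul Finset.univ _ (d : ℤ) fun l _ => ?_).trans (by simp)
  exact_mod_cast hd _

theorem resolution_vanishAt_zero {r : ℕ} (hr : ∀ e : ℤ, r < e → ∀ p ∈ polyPiece k n e,
      p ∈ Ideal.span (Set.range f)) (e : ℤ) (he : r < e) :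
    (generatorMatrix f deg hf).resolution.VanishAt 0 e := by
  intro v hv _
  have hv' := hv () ()
  rw [show (generatorMatrix f deg hf).resolution.deg 0 () = 0 from rfl, sub_zero] at hv'
  obtain ⟨c, hc⟩ := (Submodule.mem_span_range_iff_exists_fun _).mp (hr e he _ hv')
  refine ⟨Matrix.of fun j _ => c j, ?_⟩
  ext1 i j
  refine Eq.trans ?_ hc
  refine (Matrix.mul_apply).trans ?_
  exact Finset.sum_congr rfl fun j _ => mul_comm _ _

theorem koszulComplex_vanishAt {r c : ℕ} (hr : ∀ e : ℤ, r < e → ∀ p ∈ polyPiece k n e,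
      p ∈ Ideal.span (Set.range f)) (hdeg : ∀ j, deg j ≤ r + 1) (hrc : r + 1 ≤ c)
    (h : ∀ q a, (generatorMatrix f deg hf).resolution.deg (q + 2) a ≤ (q + 1) * c)
    (i : ℕ) (e : ℤ) (he : (r + c * i : ℤ) < e) : (koszulComplex f deg hf).VanishAt i e := by
  refine GradedComplex.vanishAt_of_resolution (koszulComplex f deg hf)
    (generatorMatrix f deg hf).resolution rfl (GradedMatrix.resolution_vanishAt _)
    (resolution_vanishAt_zero hf hr) h hrc
    (fun p a => ?_) (fun p v hv a => koszulComplex_smul_boundary hf p v hv a) i e he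
  exact (koszulDeg_le hdeg p a).trans (by push_cast; rfl)

theorem resolution_deg_le {r : ℕ} (hr : ∀ e : ℤ, r < e → ∀ p ∈ polyPiece k n e,
      p ∈ Ideal.span (Set.range f)) (hdeg : ∀ j, deg j ≤ r + 1) (q : ℕ) (a) :
    (generatorMatrix f deg hf).resolution.deg (q + 1) a ≤ r + q + 1 := by
  obtain ⟨X, hu, hXdeg, hX, hX0⟩ := GradedComplex.exists_linear_resolution k n
  refine GradedComplex.deg_le_of_linear X _ hX hX0 hXdeg (GradedMatrix.resolution_vanishAt _)
    (resolution_vanishAt_zero hf hr) (fun j => ?_) (GradedMatrix.resolution_minimal _) q a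
  change (deg j : ℤ) ≤ (r : ℤ) + 1
  exact_mod_cast hdeg j

/-- If `I` is generated by linear forms in at most one variable, then the homology of the Koszul
complex is concentrated in the lowest possible degrees. -/
theorem koszulComplex_vanishAt_of_subsingleton [Subsingleton (Fin n)]
    (hr : ∀ e : ℤ, 0 < e → ∀ p ∈ polyPiece k n e, p ∈ Ideal.span (Set.range f))
    (hdeg : ∀ j, deg j ≤ 1) (i : ℕ) (e : ℤ) (he : i < e) :
    (koszulComplex f deg hf).VanishAt i e := by
  intro v hv hc
  have hspan : ∀ s, v s () ∈ Ideal.span (Set.range (MvPolynomial.X (R := k) (σ := Fin n))) := by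
    intro s
    have h1 : (koszulComplex f deg hf).deg i s ≤ i := by
      have := koszulDeg_le hdeg i s
      rwa [Nat.cast_one, mul_one] at this
    have h2 := hv s ()
    obtain ⟨d, hd⟩ := Int.eq_ofNat_of_zero_le
      (show 0 ≤ e - (koszulComplex f deg hf).deg i s - 1 by omega)
    rw [show e - (koszulComplex f deg hf).deg i s = ((d + 1 : ℕ) : ℤ) by push_cast; omega,
      mem_polyPiece_natCast] at h2
    exact mem_span_X_of_isHomogeneous h2
  rcases isEmpty_or_nonempty (Fin n) with hn | ⟨⟨l⟩⟩
  · refine ⟨0, ?_⟩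
    rw [Matrix.mul_zero]
    ext1 s j
    have := hspan s
    rw [Set.range_eq_empty, Ideal.span_empty, Ideal.mem_bot] at this
    exact this.symm
  · rw [show Set.range (MvPolynomial.X (R := k) (σ := Fin n)) = {MvPolynomial.X l} by
      ext x
      constructor
      · rintro ⟨l', rfl⟩
        rw [Subsingleton.elim l' l]
        rfl
      · rintro rfl
        exact ⟨l, rfl⟩] at hspan
    choose y hy using fun s => Ideal.mem_span_singleton'.mp (hspan s)
    obtain rfl : v = (MvPolynomial.X l : MvPolynomial (Fin n) k) • Matrix.of fun s _ => y s := by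
      ext1 s j
      rw [Matrix.smul_apply, smul_eq_mul, mul_comm]
      exact (hy s).symm
    refine koszulComplex_smul_boundary_of_mem hf i _ ?_ (hr 1 one_pos _ (X_mem_polyPiece l))
    cases i with
    | zero => trivial
    | succ i =>
      -- The variable is a nonzerodivisor, so the quotient of a cycle by it is again a cycle.
      simp only [GradedComplex.IsCycle, Matrix.mul_smul] at hc ⊢
      exact (smul_eq_zero.mp hc).resolve_left (MvPolynomial.X_ne_zero l)

/-- If `I = (x_1, …, x_n)` has only constant syzygies, then there is at most one variable. -/
theorem subsingleton_of_syzygiesGeneratedBy (hf : ∀ j, (f j).IsHomogeneous (deg j))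
    (hr : ∀ e : ℤ, 0 < e → ∀ p ∈ polyPiece k n e, p ∈ Ideal.span (Set.range f))
    (hI : Ideal.span (Set.range f) ≠ ⊤) (hdeg : ∀ j, deg j ≤ 1)
    (hsyz : SyzygiesGeneratedBy (fun j => (deg j : ℤ))
      (Matrix.of fun (_ : Unit) j => f j) 1) : Subsingleton (Fin n) := by
  classical
  refine ⟨fun i j => ?_⟩
  by_contra hij
  -- A generator of degree 0 is a constant, and it must vanish because `I` is proper.
  have hf0 : ∀ l, deg l ≠ 1 → f l = 0 := by
    intro l hl
    have h0 : deg l = 0 := by have := hdeg l; omega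
    have h1 := hf l
    rw [h0, ← MvPolynomial.totalDegree_zero_iff_isHomogeneous,
      MvPolynomial.totalDegree_eq_zero_iff_eq_C] at h1
    by_contra hne
    refine hI (Ideal.eq_top_of_isUnit_mem _ (Ideal.subset_span ⟨l, rfl⟩) ?_)
    rw [h1] at hne ⊢
    exact (isUnit_iff_ne_zero.mpr fun h => hne (by rw [h, map_zero])).map MvPolynomial.C
  obtain ⟨a, ha, hai⟩ := exists_coeff_of_mem_span hf (X_mem_polyPiece i)
    (hr 1 one_pos _ (X_mem_polyPiece i))
  obtain ⟨b, hb, hbj⟩ := exists_coeff_of_mem_span hf (X_mem_polyPiece j)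
    (hr 1 one_pos _ (X_mem_polyPiece j))
  have hconst : ∀ (c : MvPolynomial (Fin n) k) (e : ℤ), e ≤ 1 → ∀ l, deg l = 1 →
      c ∈ polyPiece k n (e - deg l) → c = MvPolynomial.C (MvPolynomial.coeff 0 c) := by
    intro c e he l hl hc
    rcases he.lt_or_eq with h | rfl
    · rw [eq_zero_of_mem_polyPiece_neg (by omega) hc]
      simp
    · rw [hl, Nat.cast_one, sub_self, ← Nat.cast_zero, mem_polyPiece_natCast,
        ← MvPolynomial.totalDegree_zero_iff_isHomogeneous,
        MvPolynomial.totalDegree_eq_zero_iff_eq_C] at hc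
      exact hc
  -- A syzygy of degree below 2 has constant entries wherever `f l ≠ 0`, so taking the coefficient
  -- of `X j` in its multiples preserves the relation. Quantifying over the multiplier `c` makes the
  -- property stable under scalars.
  have key : ∀ z ∈ Submodule.span (MvPolynomial (Fin n) k)
      {y : Matrix (Fin m) Unit (MvPolynomial (Fin n) k) |
        (Matrix.of fun (_ : Unit) j => f j) * y = 0 ∧
          ∃ e' < (2 : ℤ), GradedMat (fun j => (deg j : ℤ)) (fun _ => e') y},
      ∀ c : MvPolynomial (Fin n) k,
        ∑ l, MvPolynomial.C (MvPolynomial.coeff (Finsupp.single j 1) (c * z l ())) * f l = 0 := by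
    intro z hz
    induction hz using Submodule.span_induction with
    | mem y hy =>
      obtain ⟨hy, e', he', hg⟩ := hy
      intro c
      have h0 := congrFun (congrFun hy ()) ()
      rw [Matrix.mul_apply] at h0
      calc _ = MvPolynomial.C (MvPolynomial.coeff (Finsupp.single j 1) c) * ∑ l, f l * y l () := by
            rw [Finset.mul_sum]
            refine Finset.sum_congr rfl fun l _ => ?_
            by_cases hl : deg l = 1
            · rw [hconst (y l ()) e' (by omega) l hl (hg l ()), mul_comm c,
                MvPolynomial.coeff_C_mul, map_mul]
              ring
            · rw [hf0 l hl]; ring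
        _ = 0 := by
            have h0' : ∑ l, f l * y l () = 0 := h0
            rw [h0', mul_zero]
    | zero => simp
    | add y z _ _ hy hz =>
      intro c
      have := congrArg₂ (· + ·) (hy c) (hz c)
      simpa [mul_add, add_mul, Finset.sum_add_distrib] using this
    | smul b y _ hy =>
      intro c
      simpa [mul_assoc] using hy (c * b)
  -- The test syzygy expresses `X j * X i - X i * X j = 0`. Extracting the coefficient of `X j`
  -- leaves the relation `∑ a_l f_l = 0`, that is, `X i = 0`.
  have hz := key _ (hsyz 2 (by norm_num)
    (Matrix.of fun l _ => MvPolynomial.X j * a l - MvPolynomial.X i * b l) (fun l _ => ?_) ?_) 1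
  · refine MvPolynomial.X_ne_zero (R := k) i ?_
    rw [← hai, ← hz]
    refine Finset.sum_congr rfl fun l _ => ?_
    rw [Matrix.of_apply]
    by_cases hl : deg l = 1
    · rw [hconst (a l) 1 le_rfl l hl (ha l), hconst (b l) 1 le_rfl l hl (hb l)]
      simp [mul_comm (MvPolynomial.X _) (MvPolynomial.C _), MvPolynomial.coeff_C_mul,
        MvPolynomial.coeff_X, Finsupp.single_left_inj, hij]
    · rw [hf0 l hl, mul_zero, mul_zero]
  · have h1 := mul_mem_polyPiece (X_mem_polyPiece (k := k) j) (ha l)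
    have h2 := mul_mem_polyPiece (X_mem_polyPiece (k := k) i) (hb l)
    have := Submodule.sub_mem _ h1 h2
    rwa [← add_sub_assoc] at this
  · ext1 u v
    rw [Matrix.mul_apply]
    simp only [Matrix.of_apply, mul_sub, Finset.sum_sub_distrib]
    have h1 : ∑ l, f l * (MvPolynomial.X j * a l) = MvPolynomial.X j * MvPolynomial.X i := by
      rw [← hai, Finset.mul_sum]
      exact Finset.sum_congr rfl fun l _ => by ring
    have h2 : ∑ l, f l * (MvPolynomial.X i * b l) = MvPolynomial.X i * MvPolynomial.X j := by
      rw [← hbj, Finset.mul_sum]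
      exact Finset.sum_congr rfl fun l _ => by ring
    rw [h1, h2, mul_comm, sub_self]
    rfl

end Ideals


/-! ### Homogeneous components and reduction in graded free modules. -/

section FreeModules

variable {k : Type u} [Field k] {n : ℕ} {α β : Type*}

/-- The homogeneous component of degree `e` of an element of a graded free module. -/
noncomputable def finsuppComp (deg : α → ℤ) (e : ℤ) (v : α →₀ MvPolynomial (Fin n) k) :
    α →₀ MvPolynomial (Fin n) k :=
  Finsupp.onFinset v.support (fun a => polyComp (e - deg a) (v a)) fun a ha => by
    rw [Finsupp.mem_support_iff]
    intro h
    rw [h, map_zero] at ha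
    exact ha rfl

@[simp]
theorem finsuppComp_apply (deg : α → ℤ) (e : ℤ) (v : α →₀ MvPolynomial (Fin n) k) (a : α) :
    finsuppComp deg e v a = polyComp (e - deg a) (v a) := rfl

theorem finsuppComp_mem (deg : α → ℤ) (e : ℤ) (v : α →₀ MvPolynomial (Fin n) k) :
    finsuppComp deg e v ∈ freePiece deg e := fun _ => polyComp_mem _ _

theorem finsuppComp_eq_self {deg : α → ℤ} {e : ℤ} {v : α →₀ MvPolynomial (Fin n) k}
    (hv : v ∈ freePiece deg e) : finsuppComp deg e v = v := Finsupp.ext fun a => by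
  rw [finsuppComp_apply, polyComp_of_mem (hv a), if_pos rfl]

theorem map_eq_sum_smul {M : Type*} [AddCommGroup M] [Module (MvPolynomial (Fin n) k) M]
    (φ : (α →₀ MvPolynomial (Fin n) k) →ₗ[MvPolynomial (Fin n) k] M)
    (v : α →₀ MvPolynomial (Fin n) k) :
    φ v = v.sum fun a b => b • φ (Finsupp.single a 1) := by
  conv_lhs => rw [← v.sum_single, Finsupp.sum, map_sum]
  refine Finset.sum_congr rfl fun a _ => ?_
  change _ = v a • φ (Finsupp.single a 1)
  rw [← map_smul, Finsupp.smul_single, smul_eq_mul, mul_one]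

theorem polyComp_functional {deg : α → ℤ} {d : ℤ}
    {φ : (α →₀ MvPolynomial (Fin n) k) →ₗ[MvPolynomial (Fin n) k] MvPolynomial (Fin n) k}
    (hφ : ∀ a, φ (Finsupp.single a 1) ∈ polyPiece k n (deg a - d)) (e : ℤ)
    (v : α →₀ MvPolynomial (Fin n) k) : polyComp (e - d) (φ v) = φ (finsuppComp deg e v) := by
  rw [map_eq_sum_smul φ v, map_eq_sum_smul φ (finsuppComp deg e v),
    Finsupp.sum_of_support_subset (finsuppComp deg e v) (s := v.support)
      Finsupp.support_onFinset_subset _ (by simp), Finsupp.sum, map_sum]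
  refine Finset.sum_congr rfl fun a _ => ?_
  rw [finsuppComp_apply, smul_eq_mul, smul_eq_mul, mul_comm, polyComp_mul (hφ a), mul_comm,
    sub_sub_sub_cancel_right]

theorem finsuppComp_map {deg : α → ℤ} {deg' : β → ℤ}
    {φ : (α →₀ MvPolynomial (Fin n) k) →ₗ[MvPolynomial (Fin n) k] (β →₀ MvPolynomial (Fin n) k)}
    (hφ : ∀ a, φ (Finsupp.single a 1) ∈ freePiece deg' (deg a)) (e : ℤ)
    (v : α →₀ MvPolynomial (Fin n) k) : finsuppComp deg' e (φ v) = φ (finsuppComp deg e v) :=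
  Finsupp.ext fun b =>
    polyComp_functional (φ := (Finsupp.lapply b).comp φ) (d := deg' b) (fun a => hφ a b) e v

theorem constantCoeff_eq_zero_of_mem {e : ℤ} {p : MvPolynomial (Fin n) k}
    (hp : p ∈ polyPiece k n e) (he : e ≠ 0) : MvPolynomial.constantCoeff p = 0 := by
  rcases lt_or_ge e 0 with h | h
  · rw [eq_zero_of_mem_polyPiece_neg h hp, map_zero]
  · lift e to ℕ using h
    rw [mem_polyPiece_natCast] at hp
    exact hp.coeff_eq_zero (by simpa using fun h => he (by exact_mod_cast h.symm))

theorem eq_zero_of_constantCoeff_eq_zero {p : MvPolynomial (Fin n) k}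
    (hp : p ∈ polyPiece k n 0) (h : MvPolynomial.constantCoeff p = 0) : p = 0 := by
  rw [← Nat.cast_zero, mem_polyPiece_natCast, ← MvPolynomial.totalDegree_zero_iff_isHomogeneous,
    MvPolynomial.totalDegree_eq_zero_iff_eq_C] at hp
  rw [hp, ← MvPolynomial.constantCoeff_eq, h, map_zero]

theorem constantCoeff_polyComp_eq_zero {p : MvPolynomial (Fin n) k}
    (hp : MvPolynomial.constantCoeff p = 0) (e : ℤ) :
    MvPolynomial.constantCoeff (polyComp e p) = 0 := by
  by_cases he : e = 0
  · subst he
    rw [polyComp, if_pos le_rfl, Int.toNat_zero, MvPolynomial.homogeneousComponent_zero,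
      MvPolynomial.constantCoeff_C]
    exact hp
  · exact constantCoeff_eq_zero_of_mem (polyComp_mem _ _) he

end FreeModules

/-! ### From vanishing of Tor to degrees of syzygies. -/

namespace GradedFreeResolution

variable {k : Type u} [Field k] {n : ℕ} {I : Ideal (MvPolynomial (Fin n) k)}
  (F : GradedFreeResolution.{u, w} I)

/-- Reduction modulo `(x_1, …, x_n)`. -/
noncomputable def bar {α : Type*} (v : α →₀ MvPolynomial (Fin n) k) : α →₀ k :=
  v.mapRange MvPolynomial.constantCoeff (map_zero _)

theorem dBar_bar (i : ℕ) (v : F.ι (i + 1) →₀ MvPolynomial (Fin n) k) :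
    F.dBar i (bar v) = bar (F.d i v) := by
  induction v using Finsupp.induction_linear with
  | zero => simp [bar]
  | add v w hv hw =>
    have h : ∀ {α : Type w} (v w : α →₀ MvPolynomial (Fin n) k), bar (v + w) = bar v + bar w :=
      fun v w => Finsupp.mapRange_add (fun _ _ => map_add _ _ _) v w
    rw [h, map_add, map_add, h, hv, hw]
  | single a p =>
    rw [show Finsupp.single a p = p • Finsupp.single a (1 : MvPolynomial (Fin n) k) by simp,
      map_smul]
    ext b
    simp [bar, dBar]

theorem torPiece_eq_bot {e : ℤ} {i : ℕ} (h : F.torPiece i e = ⊥) (y : F.ι i →₀ k)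
    (hy : y ∈ F.torCycles i) (hdeg : ∀ a, y a ≠ 0 → F.deg i a = e) :
    ∃ u, F.dBar i u = y := by
  have h1 : (Submodule.Quotient.mk (⟨y, hy⟩ : F.torCycles i) :
      F.Tor i) ∈ F.torPiece i e := by
    refine Submodule.mem_map_of_mem (p := Submodule.comap _ _) (r := (⟨y, hy⟩ : F.torCycles i)) ?_
    change y ∈ Finsupp.supported k k {a | F.deg i a = e}
    intro a ha
    exact hdeg a (Finsupp.mem_support_iff.mp ha)
  rw [h] at h1
  exact (Submodule.Quotient.mk_eq_zero _).mp ((Submodule.mem_bot _).mp h1)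

theorem torPiece_eq_bot_of_lt {i : ℕ} {s : ℕ} (h : F.t i ≤ ((s : ℝ) : EReal)) {e : ℤ}
    (he : s < e) : F.torPiece i e = ⊥ := by
  by_contra hne
  have h1 : ((e : ℝ) : EReal) ≤ ((s : ℝ) : EReal) := 
    le_trans (le_sSup (Set.mem_image_of_mem (fun e : ℤ => ((e : ℝ) : EReal)) hne)) h
  rw [EReal.coe_le_coe_iff] at h1
  exact absurd he (not_lt.mpr (by exact_mod_cast h1))

/-- A syzygy of degree `e` which is `0` modulo `(x_1, …, x_n)` is a combination of syzygies of
degree `< e` if `Tor_1^B(I, k)` vanishes in degree `e`. -/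
theorem exists_lift_of_torPiece_eq_bot {e : ℤ} (h : F.torPiece 1 e = ⊥)
    {w : F.ι 0 →₀ MvPolynomial (Fin n) k} (hw : w ∈ freePiece (F.deg 0) e) (haug : F.aug w = 0)
    (hbar : bar w = 0) :
    ∃ y ∈ freePiece (F.deg 1) e, F.d 0 y = w ∧ ∀ a, y a ≠ 0 → F.deg 1 a < e := by
  obtain ⟨y₀, hy₀⟩ : w ∈ LinearMap.range (F.d 0) := by
    rw [F.exact_zero]; exact haug
  have hy : finsuppComp (F.deg 1) e y₀ ∈ freePiece (F.deg 1) e := finsuppComp_mem _ _ _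
  have hdy : F.d 0 (finsuppComp (F.deg 1) e y₀) = w := by
    rw [← finsuppComp_map (F.d_homogeneous 0), hy₀, finsuppComp_eq_self hw]
  -- Since `w` reduces to zero, the reduction of its lift is a cycle. By homogeneity it is supported
  -- on basis elements of degree `e`, so vanishing of Tor makes it a boundary.
  obtain ⟨u, hu⟩ := F.torPiece_eq_bot h (bar (finsuppComp (F.deg 1) e y₀))
    (show F.dBar 0 _ = 0 by rw [dBar_bar, hdy, hbar]) (fun a ha => by
      by_contra hne
      exact ha (constantCoeff_eq_zero_of_mem (hy a) (sub_ne_zero.mpr (Ne.symm hne))))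
  let U : F.ι 2 →₀ MvPolynomial (Fin n) k := u.mapRange MvPolynomial.C (map_zero _)
  have hU : bar U = u := by ext b; simp [bar, U]
  have hz : ∀ a, MvPolynomial.constantCoeff ((finsuppComp (F.deg 1) e y₀ - F.d 1 U) a) = 0 := by
    intro a
    have h1 := F.dBar_bar 1 U
    rw [hU, hu] at h1
    have h2 := DFunLike.congr_fun h1 a
    simp only [bar, Finsupp.mapRange_apply] at h2
    rw [Finsupp.sub_apply, map_sub, h2, sub_self]
  -- Subtracting `d U` kills the reduction without changing the image. The coefficient at a basis
  -- element of degree `e` then has degree 0 and zero constant term, so it vanishes; basis elements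
  -- of larger degree have coefficients of negative degree.
  refine ⟨finsuppComp (F.deg 1) e (finsuppComp (F.deg 1) e y₀ - F.d 1 U),
    finsuppComp_mem _ _ _, ?_, fun a ha => ?_⟩
  · have h3 : F.d 0 (F.d 1 U) = 0 := by
      have : F.d 1 U ∈ LinearMap.range (F.d (0 + 1)) := ⟨U, rfl⟩
      rw [F.exact_succ 0] at this
      exact this
    rw [← finsuppComp_map (F.d_homogeneous 0), map_sub, h3, sub_zero, hdy, finsuppComp_eq_self hw]
  · rw [finsuppComp_apply] at ha
    by_contra hle
    rcases (not_lt.mp hle).lt_or_eq with hlt | heq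
    · exact ha (eq_zero_of_mem_polyPiece_neg (by omega) (polyComp_mem _ _))
    · refine ha (eq_zero_of_constantCoeff_eq_zero ?_ (constantCoeff_polyComp_eq_zero (hz a) _))
      rw [show (0 : ℤ) = e - F.deg 1 a by omega]
      exact polyComp_mem _ _

/-- The syzygies of generators `f` of `I` are generated in degrees `≤ s` if `f` and `Tor_1^B(I, k)`
live in degrees `≤ s`. -/
theorem syzygiesGeneratedBy_of_t_le {m : ℕ} {f : Fin m → MvPolynomial (Fin n) k} {deg : Fin m → ℕ}
    (hf : ∀ j, (f j).IsHomogeneous (deg j)) (hgen : Ideal.span (Set.range f) = I) {s : ℕ}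
    (hdeg : ∀ j, deg j ≤ s) (ht : F.t 1 ≤ ((s : ℝ) : EReal)) :
    SyzygiesGeneratedBy (fun j => (deg j : ℤ)) (Matrix.of fun (_ : Unit) j => f j) s := by
  classical
  intro e he z hz hfz
  have hz0 : ∑ j, f j * z j () = 0 := by
    have := congrFun (congrFun hfz ()) ()
    rwa [Matrix.mul_apply] at this
  have hΨ : ∀ a, ∃ c : Fin m → MvPolynomial (Fin n) k,
      (∀ j, c j ∈ polyPiece k n (F.deg 0 a - deg j)) ∧
        ∑ j, c j * f j = F.aug (Finsupp.single a 1) := fun a =>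
    exists_coeff_of_mem_span hf (F.aug_homogeneous a) (by
      rw [hgen]; exact F.range_aug.le ⟨_, rfl⟩)
  choose Ψ hΨdeg hΨf using hΨ
  have hχ : ∀ j, ∃ v ∈ freePiece (F.deg 0) (deg j : ℤ), F.aug v = f j := fun j => by
    obtain ⟨v, hv⟩ : f j ∈ LinearMap.range F.aug := by
      rw [F.range_aug, ← hgen]; exact Ideal.subset_span ⟨j, rfl⟩
    refine ⟨finsuppComp (F.deg 0) (deg j) v, finsuppComp_mem _ _ _, ?_⟩
    have := polyComp_functional (d := 0) (φ := F.aug) (deg := F.deg 0)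
      (fun a => by rw [sub_zero]; exact F.aug_homogeneous a) (deg j) v
    rw [← this, hv, sub_zero, polyComp_of_mem (mem_polyPiece_natCast.mpr (hf j)), if_pos rfl]
  choose χ hχdeg hχf using hχ
  let ψ : (F.ι 0 →₀ MvPolynomial (Fin n) k) →ₗ[MvPolynomial (Fin n) k]
      (Fin m → MvPolynomial (Fin n) k) := Finsupp.linearCombination _ Ψ
  have hψdeg : ∀ v d, v ∈ freePiece (F.deg 0) d → ∀ j, ψ v j ∈ polyPiece k n (d - deg j) := by
    intro v d hv j
    simp only [ψ, Finsupp.linearCombination_apply, Finsupp.sum, Finset.sum_apply]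
    refine Submodule.sum_mem _ fun a _ => ?_
    have := mul_mem_polyPiece (hv a) (hΨdeg a j)
    rwa [sub_add_sub_cancel] at this
  have hψf : ∀ v, ∑ j, f j * ψ v j = F.aug v := by
    intro v
    rw [map_eq_sum_smul F.aug v]
    simp only [ψ, Finsupp.linearCombination_apply, Finsupp.sum, Finset.sum_apply, Finset.mul_sum]
    rw [Finset.sum_comm]
    refine Finset.sum_congr rfl fun a _ => ?_
    rw [← hΨf a, smul_eq_mul, Finset.mul_sum]
    refine Finset.sum_congr rfl fun j _ => ?_
    rw [Pi.smul_apply, smul_eq_mul]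
    ring
  let col : (Fin m → MvPolynomial (Fin n) k) →ₗ[MvPolynomial (Fin n) k]
      Matrix (Fin m) Unit (MvPolynomial (Fin n) k) :=
    { toFun := fun v => Matrix.of fun j _ => v j
      map_add' := fun _ _ => rfl
      map_smul' := fun _ _ => rfl }
  have hmem : ∀ (v : Fin m → MvPolynomial (Fin n) k) (d : ℤ), d < e →
      (∀ j, v j ∈ polyPiece k n (d - deg j)) → ∑ j, f j * v j = 0 →
      col v ∈ Submodule.span (MvPolynomial (Fin n) k)
        {y : Matrix (Fin m) Unit (MvPolynomial (Fin n) k) |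
          (Matrix.of fun (_ : Unit) j => f j) * y = 0 ∧
            ∃ e' < e, GradedMat (fun j => (deg j : ℤ)) (fun _ => e') y} := by
    intro v d hd hv hv0
    refine Submodule.subset_span ⟨?_, d, hd, fun j _ => hv j⟩
    ext1 i j
    rw [Matrix.mul_apply]
    exact hv0
  -- The maps `ψ` and `χ` compare `B^m` and `F_0` over `I`, and `x` is the image of `z` under `χ`.
  -- The entries of `z` have nonzero degree, so `x` reduces to zero.
  set x : F.ι 0 →₀ MvPolynomial (Fin n) k := ∑ j, z j () • χ j with hx
  have hlt : ∀ j, (deg j : ℤ) < e := fun j => lt_of_le_of_lt (by exact_mod_cast hdeg j) he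
  have hxdeg : x ∈ freePiece (F.deg 0) e := fun a => by
    rw [hx, Finsupp.finsetSum_apply]
    refine Submodule.sum_mem _ fun j _ => ?_
    have := mul_mem_polyPiece (hz j ()) (hχdeg j a)
    rwa [sub_add_sub_cancel] at this
  have hxaug : F.aug x = 0 := by
    rw [hx, map_sum, ← hz0]
    refine Finset.sum_congr rfl fun j _ => ?_
    rw [map_smul, hχf, smul_eq_mul, mul_comm]
  have hxbar : bar x = 0 := by
    ext a
    simp only [bar, Finsupp.mapRange_apply, hx, Finsupp.finsetSum_apply, map_sum]
    refine Finset.sum_eq_zero fun j _ => ?_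
    rw [Finsupp.smul_apply, smul_eq_mul, map_mul, constantCoeff_eq_zero_of_mem (hz j ())
      (sub_ne_zero.mpr (hlt j).ne'), zero_mul]
  obtain ⟨y, hy, hyx, hydeg⟩ := F.exists_lift_of_torPiece_eq_bot (F.torPiece_eq_bot_of_lt ht he)
    hxdeg hxaug hxbar
  have h1 : col (ψ x) ∈ Submodule.span (MvPolynomial (Fin n) k)
        {y : Matrix (Fin m) Unit (MvPolynomial (Fin n) k) |
          (Matrix.of fun (_ : Unit) j => f j) * y = 0 ∧
            ∃ e' < e, GradedMat (fun j => (deg j : ℤ)) (fun _ => e') y} := by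
    rw [← hyx, map_eq_sum_smul (F.d 0) y, Finsupp.sum, map_sum, map_sum]
    refine Submodule.sum_mem _ fun a ha => ?_
    rw [map_smul, map_smul]
    refine Submodule.smul_mem _ _ (hmem _ (F.deg 1 a) (hydeg a (Finsupp.mem_support_iff.mp ha))
      (hψdeg _ _ (F.d_homogeneous 0 a)) ?_)
    rw [hψf]
    have : F.d 0 (Finsupp.single a 1) ∈ LinearMap.range (F.d 0) := ⟨_, rfl⟩
    rw [F.exact_zero] at this
    exact this
  -- The difference of `z` and its image under `ψ ∘ χ` is a combination of the syzygies `e_j - ψ (χ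
  -- e_j)`, whose degrees `deg j` are below `e`.
  have h2 : z = col (ψ x) + ∑ j, z j () • col (Pi.single j 1 - ψ (χ j)) := by
    have h3 : ∑ j, z j () • col (Pi.single j 1 - ψ (χ j)) =
        col (∑ j, z j () • Pi.single j 1) - col (ψ x) := by
      rw [hx, map_sum, map_sum, map_sum, ← Finset.sum_sub_distrib]
      refine Finset.sum_congr rfl fun j _ => ?_
      rw [map_sub, smul_sub, map_smul, map_smul, map_smul]
    rw [h3, add_sub_cancel]
    ext1 i j
    change z i () = (∑ j, z j () • (Pi.single j 1 : Fin m → MvPolynomial (Fin n) k)) i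
    simp [Finset.sum_apply, Pi.single_apply]
  rw [h2]
  refine Submodule.add_mem _ h1 (Submodule.sum_mem _ fun j _ => Submodule.smul_mem _ _
    (hmem _ (deg j) (hlt j) (fun l => ?_) ?_))
  · rw [Pi.sub_apply]
    refine Submodule.sub_mem _ ?_ (hψdeg _ _ (hχdeg j) l)
    rw [Pi.single_apply]
    split_ifs with h
    · rw [h, sub_self]; exact one_mem_polyPiece
    · exact Submodule.zero_mem _
  · simp only [Pi.sub_apply, mul_sub, Finset.sum_sub_distrib, hψf, hχf]
    simp [Pi.single_apply]

end GradedFreeResolution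

/-! ### The bounds on the ends of Koszul homology. -/

theorem endKoszulHomology_le {k : Type u} [Field k] {n m : ℕ}
    {f : Fin m → MvPolynomial (Fin n) k} {deg : Fin m → ℕ}
    (hf : ∀ j, (f j).IsHomogeneous (deg j)) {i : ℕ} {b : ℤ}
    (h : ∀ e : ℤ, b < e → (koszulComplex f deg hf).VanishAt i e) :
    endKoszulHomology f deg i ≤ ((b : ℝ) : EReal) := by
  refine sSup_le ?_
  rintro _ ⟨e, he, rfl⟩
  rw [EReal.coe_le_coe_iff]
  by_contra hlt
  exact he (koszulHomologyPiece_eq_bot hf (h e (by exact_mod_cast not_le.mp hlt)))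

theorem corollary4p6 {k : Type u} [Field k] {n m : ℕ}
    (I : Ideal (MvPolynomial (Fin n) k)) (hI : endQuotient I < ⊤)
    (f : Fin m → MvPolynomial (Fin n) k) (deg : Fin m → ℕ)
    (hgen : Ideal.span (Set.range f) = I) (hmin : IsMinimalByDegree f deg) :
    (∀ i : ℕ, endKoszulHomology f deg i ≤ (endQuotient I + 2) * ((i : EReal) + 1) - 2) ∧
    (∀ F : GradedFreeResolution.{u, w} I, F.t 1 ≤ endQuotient I + 1 →
      ∀ i : ℕ, endKoszulHomology f deg i ≤ (endQuotient I + 1) * ((i : EReal) + 1) - 1) := by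
  have hf := hmin.homogeneous
  -- For the unit ideal, `1 ∈ I` annihilates the homology, so its end is `⊥`. Otherwise `B / I` is
  -- nonzero in degree 0 and its end is a natural number.
  by_cases hne : I = ⊤
  · have hbot : ∀ i, endKoszulHomology f deg i = ⊥ := fun i => by
      refine le_bot_iff.mp (sSup_le ?_)
      rintro _ ⟨e, he, rfl⟩
      refine absurd (koszulHomologyPiece_eq_bot hf fun v _ hc => ?_) he
      obtain ⟨w, hw⟩ := koszulComplex_smul_boundary_of_mem hf i v hc (b := 1)
        (by rw [hgen, hne]; trivial)
      exact ⟨w, by rw [hw, one_smul]⟩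
    exact ⟨fun i => by rw [hbot]; exact bot_le, fun _ _ i => by rw [hbot]; exact bot_le⟩
  obtain ⟨r, hr, hrI⟩ := exists_endQuotient hI hne
  have hrI' := hrI
  rw [← hgen] at hrI'
  have hdeg := deg_le_of_isMinimalByDegree hmin hrI'
  rw [hr]
  constructor
  · intro i
    -- The choice `c = r + 2` is dictated by `G_2`, whose degrees are at most `r + 2`; for larger
    -- `q`, `r + q + 2 ≤ (q + 1) * (r + 2)` is weaker.
    have h := endKoszulHomology_le hf (i := i) (b := r + (r + 2 : ℕ) * i) (fun e he =>
      koszulComplex_vanishAt hf hrI' hdeg (c := r + 2) (by omega) (fun q a => by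
        refine (resolution_deg_le hf hrI' hdeg (q + 1) a).trans ?_
        push_cast
        nlinarith [mul_nonneg (Nat.cast_nonneg (α := ℤ) q) (Nat.cast_nonneg (α := ℤ) r),
          Nat.cast_nonneg (α := ℤ) q]) i e he)
    refine h.trans (le_of_eq ?_)
    have : ((r + (r + 2 : ℕ) * i : ℤ) : ℝ) = ((r : ℝ) + 2) * ((i : ℝ) + 1) - 2 := by
      push_cast; ring
    rw [this, EReal.coe_sub, EReal.coe_mul, EReal.coe_add, EReal.coe_add]
    rfl
  · intro F hF i
    have hF' : F.t 1 ≤ (((r + 1 : ℕ) : ℝ) : EReal) := by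
      rw [Nat.cast_add, Nat.cast_one, EReal.coe_add, EReal.coe_one]
      exact hF
    have hsyz := F.syzygiesGeneratedBy_of_t_le hf hgen hdeg hF'
    have h := endKoszulHomology_le hf (i := i) (b := r + (r + 1 : ℕ) * i) (fun e he => by
      -- With `c = r + 1`, the bound on `G_{q+2}` for `q ≥ 1` needs `r + q + 2 ≤ (q + 1) * (r + 1)`,
      -- that is `1 ≤ q * r`, which fails for `r = 0`.
      rcases r.eq_zero_or_pos with rfl | hpos
      · have := subsingleton_of_syzygiesGeneratedBy hf (by simpa using hrI')
          (by rwa [hgen]) hdeg hsyz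
        exact koszulComplex_vanishAt_of_subsingleton hf (by simpa using hrI') hdeg i e
          (by simpa using he)
      · refine koszulComplex_vanishAt hf hrI' hdeg (c := r + 1) le_rfl (fun q a => ?_) i e he
        rcases q with _ | q
        · refine (GradedMatrix.resolution_minimal (generatorMatrix f deg hf) 0 (r + 1) hsyz a).trans (by simp)
        · refine (resolution_deg_le hf hrI' hdeg (q + 2) a).trans ?_
          push_cast
          have : (1 : ℤ) ≤ r := by exact_mod_cast hpos
          nlinarith [mul_nonneg (Nat.cast_nonneg (α := ℤ) q) (Nat.cast_nonneg (α := ℤ) r)])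
    refine h.trans (le_of_eq ?_)
    have : ((r + (r + 1 : ℕ) * i : ℤ) : ℝ) = ((r : ℝ) + 1) * ((i : ℝ) + 1) - 1 := by
      push_cast; ring
    rw [this, EReal.coe_sub, EReal.coe_mul, EReal.coe_add, EReal.coe_add]
    rfl
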